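/- Let $S$ be the once-punctured torus, $\pi_1(S)=\langle a,b\rangle$ free on $a,b$ with the commutator $[a,b]$ representing the loop around the puncture. Let $X_{par}(S)$ be the $\mathrm{PSL}(2,\mathbb{C})$-character variety, i.e. the set of conjugacy classes of irreducible representations $\rho:\pi_1(S)\to \mathrm{PSL}(2,\mathbb{C})$ that take the nontrivial peripheral elements (the conjugates of nontrivial powers of $[a,b]$) to parabolic elements. A class $[\rho]$ is given by a triple $(x,y,z)\in\mathbb{C}^3$, written $[\rho]=(x,y,z)$, if $\rho(a)=\pm A$, $\rho(b)=\pm B$ for some $A,B\in \mathrm{SL}(2,\mathbb{C})$ with $\operatorname{tr}A=x$, $\operatorname{tr}B=y$, $\operatorname{tr}AB=z$; the triple is determined up to the sign changes $(x,y,z)\mapsto(-x,y,-z)$ and $(x,y,z)\mapsto(x,-y,-z)$ and their composition. Let $\mathcal{QF}(S)\subset X_{par}(S)$ be the set of classes of quasi-Fuchsian representations (faithful, with discrete image whose domain of discontinuity in $\mathbb{C}P^1$, the complement of the limit set, consists of exactly two open topological disks). For $\lambda\in\mathbb{C}$ with $\mathrm{Re}\,\lambda\ge 0$ let $X(\lambda)=X_{1/0}(\lambda)\subset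 X_{par}(S)$ be the linear slice, the set of $[\rho]$ for which $\rho(a)$ has complex length $\lambda$ modulo $2\pi\sqrt{-1}\,\mathbb{Z}$, i.e. $\rho(a)$ is conjugate to $\pm\begin{pmatrix} e^{\lambda/2} & * \\ 0 & e^{-\lambda/2}\end{pmatrix}$. For $b_0\in\mathbb{R}$ let $$\mathcal{D}=\{\lambda\in\mathbb{C}\mid \mathrm{Re}\,\lambda>0,\ -\pi<\mathrm{Im}\,\lambda\le\pi\}\times\{\tau\in\mathbb{C}\mid b_0\le \mathrm{Im}\,\tau<b_0+2\pi\}.$$ Then the triple $$\psi_{FN}(\lambda,\tau)=\left(2\cosh(\lambda/2),\ \frac{2\cosh(\tau/2)}{\tanh(\lambda/2)},\ \frac{2\cosh((\tau+\lambda)/2)}{\tanh(\lambda/2)}\right)$$ determines exactly one class in $X_{par}(S)$ for every $(\lambda,\tau)\in\mathcal{D}$, and so defines a map $\psi_{FN}:\mathcal{D}\to X_{par}(S)$. This map is injective, and its image contains $\mathcal{QF}(S)$ entirely. Moreover, for each fixed $\lambda$ with $\mathrm{Re}\,\lambda>0$ and $-\pi<\mathrm{Im}\,\lambda\le\pi$,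 $\psi_{FN}(\lambda,\cdot)$ takes values in $X(\lambda)$ and is a bijection from $\{\tau\in\mathbb{C}\mid b_0\le\mathrm{Im}\,\tau<b_0+2\pi\}$ onto $X(\lambda)$. -/

import Mathlib

open Matrix Topology Filter
open scoped ComplexOrder

noncomputable section

namespace PuncturedTorus

/-- The group `PSL(2, ℂ)`. -/
abbrev PSL2C : Type := Matrix.ProjectiveSpecialLinearGroup (Fin 2) ℂ

/-- The class `± A` in `PSL(2, ℂ)` of a matrix `A` in `SL(2, ℂ)`. -/
def toPSL : Matrix.SpecialLinearGroup (Fin 2) ℂ →* PSL2C :=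
  QuotientGroup.mk' (Subgroup.center (Matrix.SpecialLinearGroup (Fin 2) ℂ))

/-- `± A` is parabolic: `A` is not scalar and its characteristic polynomial has a double root. -/
def IsParabolicElt (g : PSL2C) : Prop :=
  ∃ A : Matrix.SpecialLinearGroup (Fin 2) ℂ, toPSL A = g ∧
    (A : Matrix (Fin 2) (Fin 2) ℂ).IsParabolic

/-! ### Representations of the fundamental group of the once-punctured torus -/

/-- The fundamental group of the once-punctured torus: the free group on two generators. -/
abbrev Pi1 : Type := FreeGroup (Fin 2)

/-- The generator `a`, representing the simple closed curve of slope `1/0`. -/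
def genA : Pi1 := FreeGroup.of 0

/-- The generator `b`, representing the simple closed curve of slope `0/1`. -/
def genB : Pi1 := FreeGroup.of 1

/-- The nontrivial peripheral elements: the conjugates of the nontrivial powers of the loop
`[a, b]` around the puncture. -/
def IsPeripheral (w : Pi1) : Prop :=
  ∃ (g : Pi1) (n : ℤ), n ≠ 0 ∧ w = g * (genA * genB * genA⁻¹ * genB⁻¹) ^ n * g⁻¹

/-- The representation takes peripheral elements to parabolic elements. -/
def IsTypePreserving (ρ : Pi1 →* PSL2C) : Prop :=
  ∀ w, IsPeripheral w → IsParabolicElt (ρ w)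

/-- The representation is irreducible: its image fixes no point of `ℂP¹`, that is, the lifts to
`SL(2, ℂ)` of its elements have no common eigenvector. -/
def IsIrreducibleRep (ρ : Pi1 →* PSL2C) : Prop :=
  ¬ ∃ v : Fin 2 → ℂ, v ≠ 0 ∧
    ∀ (w : Pi1) (A : Matrix.SpecialLinearGroup (Fin 2) ℂ), toPSL A = ρ w →
      ∃ c : ℂ, (A : Matrix (Fin 2) (Fin 2) ℂ) *ᵥ v = c • v

/-- The irreducible representations taking peripheral elements to parabolic elements. -/
abbrev IrrRep : Type := {ρ : Pi1 →* PSL2C // IsTypePreserving ρ ∧ IsIrreducibleRep ρ}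

/-- Conjugation by elements of `PSL(2, ℂ)`. -/
instance conjSetoid : Setoid IrrRep where
  r ρ σ := ∃ g : PSL2C, ∀ w, σ.1 w = g * ρ.1 w * g⁻¹
  iseqv :=
    { refl := fun ρ => ⟨1, fun w => by simp⟩
      symm := by
        rintro ρ σ ⟨g, hg⟩
        refine ⟨g⁻¹, fun w => ?_⟩
        rw [hg w]
        group
      trans := by
        rintro ρ σ υ ⟨g, hg⟩ ⟨h, hh⟩
        refine ⟨h * g, fun w => ?_⟩
        rw [hh w, hg w]
        group }

/-- The `PSL(2, ℂ)`-character variety `X_par(S)`: conjugacy classes of irreducible representations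
taking peripheral elements to parabolic elements. -/
def CharVar : Type := Quotient conjSetoid

/-- The class `c` has trace coordinates `(x, y, z)`: it is the image in the
`PSL(2, ℂ)`-character variety of the class of an `SL(2, ℂ)`-representation `a ↦ A`, `b ↦ B` with
`tr A = x`, `tr B = y`, `tr (A B) = z`. (Changing the signs of `A` and `B` changes `(x, y, z)` by
the action of `H¹(S; ℤ/2)`.) -/
def HasTraceCoords (c : CharVar) (x y z : ℂ) : Prop :=
  ∃ ρ : IrrRep, Quotient.mk conjSetoid ρ = c ∧
    ∃ A B : Matrix.SpecialLinearGroup (Fin 2) ℂ,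
      toPSL A = ρ.1 genA ∧ toPSL B = ρ.1 genB ∧
      (A : Matrix (Fin 2) (Fin 2) ℂ).trace = x ∧
      (B : Matrix (Fin 2) (Fin 2) ℂ).trace = y ∧
      ((A * B : Matrix.SpecialLinearGroup (Fin 2) ℂ) : Matrix (Fin 2) (Fin 2) ℂ).trace = z

/-! ### Complex length and linear slices -/

/-- `g` has complex length `l` (which is defined modulo `2πi`): the real part of `l` is
non-negative and `g` is conjugate to the class of an upper triangular matrix with diagonal entries
`exp (l / 2)` and `exp (-l / 2)`. -/
def HasComplexLength (g : PSL2C) (l : ℂ) : Prop :=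
  0 ≤ l.re ∧ ∃ (M : Matrix.SpecialLinearGroup (Fin 2) ℂ) (s : ℂ),
    (M : Matrix (Fin 2) (Fin 2) ℂ) = !![Complex.exp (l / 2), s; 0, Complex.exp (-l / 2)] ∧
    IsConj g (toPSL M)

/-- The linear slice `X(l) = X_{1/0}(l)`. -/
def linearSlice (l : ℂ) : Set CharVar :=
  {c | ∃ ρ : IrrRep, Quotient.mk conjSetoid ρ = c ∧ HasComplexLength (ρ.1 genA) l}

/-! ### Quasi-Fuchsian representations

Hyperbolic 3-space in its projective (Klein) model: points are the positive definite Hermitian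
`2 × 2` matrices of trace one, points of the ideal boundary `ℂP¹` are the positive semidefinite
Hermitian matrices of trace one and determinant zero (the orthogonal projections onto the lines in
`ℂ²`), and `A` in `SL(2, ℂ)` acts by `M ↦ A M Aᴴ`, normalized to trace one. -/

/-- Hyperbolic 3-space. -/
def HypSpace : Set (Matrix (Fin 2) (Fin 2) ℂ) :=
  {M | M.PosDef ∧ M.trace = 1}

/-- The ideal boundary of hyperbolic 3-space, the Riemann sphere. -/
def IdealBoundary : Set (Matrix (Fin 2) (Fin 2) ℂ) :=
  {M | M.PosSemidef ∧ M.trace = 1 ∧ M.det = 0}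

/-- The action of `SL(2, ℂ)`; it depends only on the class `± A`. -/
def hypAct (A : Matrix.SpecialLinearGroup (Fin 2) ℂ) (M : Matrix (Fin 2) (Fin 2) ℂ) :
    Matrix (Fin 2) (Fin 2) ℂ :=
  ((A : Matrix (Fin 2) (Fin 2) ℂ) * M * (A : Matrix (Fin 2) (Fin 2) ℂ)ᴴ).trace⁻¹ •
    ((A : Matrix (Fin 2) (Fin 2) ℂ) * M * (A : Matrix (Fin 2) (Fin 2) ℂ)ᴴ)

/-- The orbit of a point under a subgroup of `PSL(2, ℂ)`. -/
def hypOrbit (Γ : Subgroup PSL2C) (p : Matrix (Fin 2) (Fin 2) ℂ) :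
    Set (Matrix (Fin 2) (Fin 2) ℂ) :=
  {M | ∃ A : Matrix.SpecialLinearGroup (Fin 2) ℂ, toPSL A ∈ Γ ∧ M = hypAct A p}

/-- The limit set: the accumulation points in the ideal boundary of an orbit in hyperbolic
3-space. -/
def limitSet (Γ : Subgroup PSL2C) : Set IdealBoundary :=
  {ξ | ∃ p ∈ HypSpace, AccPt (ξ : Matrix (Fin 2) (Fin 2) ℂ) (𝓟 (hypOrbit Γ p))}

/-- The domain of discontinuity. -/
def discontinuityDomain (Γ : Subgroup PSL2C) : Set IdealBoundary := (limitSet Γ)ᶜ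

/-- An open (topological) disk in the Riemann sphere. -/
def IsOpenDisk (U : Set IdealBoundary) : Prop :=
  IsOpen U ∧ Nonempty (U ≃ₜ Metric.ball (0 : ℂ) 1)

/-- The representation is quasi-Fuchsian: it is faithful, its image is discrete, and the domain of
discontinuity of the image consists of exactly two open disks. -/
def IsQuasiFuchsian (ρ : Pi1 →* PSL2C) : Prop :=
  Function.Injective ρ ∧ DiscreteTopology ρ.range ∧
    ∃ U V : Set IdealBoundary, IsOpenDisk U ∧ IsOpenDisk V ∧ Disjoint U V ∧
      discontinuityDomain ρ.range = U ∪ V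

/-- The quasi-Fuchsian space `QF(S)` in `X_par(S)`. -/
def QFSpace : Set CharVar :=
  {c | ∃ ρ : IrrRep, Quotient.mk conjSetoid ρ = c ∧ IsQuasiFuchsian ρ.1}

/-! ### The domain of the complex Fenchel–Nielsen map -/

/-- The pairs `(l, t)` with `Re l > 0`, `-π < Im l ≤ π` and `b₀ ≤ Im t < b₀ + 2π`. -/
def fnDomain (b₀ : ℝ) : Set (ℂ × ℂ) :=
  {p | 0 < p.1.re ∧ -Real.pi < p.1.im ∧ p.1.im ≤ Real.pi ∧
    b₀ ≤ p.2.im ∧ p.2.im < b₀ + 2 * Real.pi}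

end PuncturedTorus

end

open Matrix Topology Filter
open scoped ComplexOrder

noncomputable section

namespace PuncturedTorus

/-! Trace coordinates turn the statement into algebra on the Markov surface. For lifts `A`, `B` of
the images of the generators, the trace of the commutator is `x² + y² + z² - xyz - 2`. It is `±2`
because the commutator is parabolic, and the value `2` would force a common eigenvector, so `x² + y²
+ z² = xyz`. Conversely a solution with `x ≠ 0` comes from a representation of the required kind,
and the triple fixes the pair `(A, B)` up to conjugacy (`exists_conj_of_trace_eq`). A class has one
triple up to signs.

Fix `x = E + E⁻¹` with `E = exp (l / 2)`, `|E| > 1`. The Markov equation becomes the conic `(z - E⁻¹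
y)(E y - z) = x²`, which is parametrized by `T ≠ 0` through `z - E⁻¹ y = T x`, `E y - z = T⁻¹ x`.
With `T = exp (t / 2)` these are the Fenchel–Nielsen formulas. The sign ambiguities replace `E`, `T`
by `±E`, `±T`, so a class determines exactly `E² = exp l` and `T² = exp t`, hence `l` and `t` in
their strips. This gives injectivity and the bijection onto each slice.

It remains that `ρ(a)` is loxodromic when `ρ` is quasi-Fuchsian. Elliptic elements have bounded
powers, contradicting faithfulness and discreteness. If `ρ(a)` is parabolic, normalize it to `z ↦ z
+ 2`; the Markov equation then forces `ρ(b)` to be `z ↦ 1 / (z + μ)`, and `a`, `bab⁻¹` map to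
generators of `Γ(2)` modulo `±1`. So the limit set contains the real circle and its preimage `Im z =
-Im μ` under `b`.

When `Im μ ≠ 0` these circles cut the sphere into three regions. The domain of discontinuity is
dense (`dense_discontinuityDomain`), so it meets all three, which two disks cannot do
(`not_isQuasiFuchsian_of_normalForm`).

When `Im μ = 0` (`slant_im_ne_zero`), `b²` acts on the upper half-plane, and reduction theory finds
parabolics `uₙ` in `Γ(2)` such that all `b⁻²ⁿ uₙ b²ⁿ` lie in a bounded set. Discreteness makes two
of them equal, and faithfulness makes the words equal. But the affine action `a : q ↦ q + 1`, `b : q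
↦ 2q` sends that word to translation by `r / 4ⁿ` with `r ∈ {±1, ±2}`, which separates different `n`.
-/

/-- The group `SL(2, ℂ)`. -/
abbrev SL2C : Type := Matrix.SpecialLinearGroup (Fin 2) ℂ

/-! ### Lifts from `PSL(2, ℂ)` to `SL(2, ℂ)` -/

lemma toPSL_surjective : Function.Surjective toPSL := QuotientGroup.mk'_surjective _

lemma mem_center_SL2C_iff (A : SL2C) : A ∈ Subgroup.center SL2C ↔ A = 1 ∨ A = -1 := by
  rw [Matrix.SpecialLinearGroup.mem_center_iff]
  constructor
  · rintro ⟨r, hr, h⟩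
    rw [Fintype.card_fin, sq_eq_one_iff] at hr
    rcases hr with rfl | rfl
    · left; ext i j; rw [← h]; simp
    · right
      ext1
      rw [← h, Matrix.SpecialLinearGroup.coe_neg, Matrix.SpecialLinearGroup.coe_one, map_neg,
        map_one]
  · rintro (rfl | rfl)
    · exact ⟨1, by simp, by simp⟩
    · refine ⟨-1, by simp, ?_⟩
      rw [Matrix.SpecialLinearGroup.coe_neg, Matrix.SpecialLinearGroup.coe_one, map_neg, map_one]

lemma toPSL_eq_iff {A B : SL2C} : toPSL A = toPSL B ↔ A = B ∨ A = -B := by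
  change ((A : SL2C ⧸ Subgroup.center SL2C) = B) ↔ _
  rw [QuotientGroup.eq, mem_center_SL2C_iff, inv_mul_eq_one, inv_mul_eq_iff_eq_mul]
  constructor
  · rintro (h | h)
    · exact Or.inl h
    · right; rw [h]; simp
  · rintro (h | h)
    · exact Or.inl h
    · right; rw [h]; simp

@[simp] lemma toPSL_neg (A : SL2C) : toPSL (-A) = toPSL A := toPSL_eq_iff.2 (Or.inr rfl)

lemma det_SL2C (A : SL2C) : A.1 0 0 * A.1 1 1 - A.1 0 1 * A.1 1 0 = 1 := by
  rw [← Matrix.det_fin_two]; exact A.2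

lemma trace_inv_SL2C (A : SL2C) : (A⁻¹ : SL2C).1.trace = A.1.trace := by
  rw [Matrix.SpecialLinearGroup.coe_inv, Matrix.adjugate_fin_two, Matrix.trace_fin_two_of,
    Matrix.trace_fin_two, add_comm]

/-- The element of `SL(2, ℂ)` with the given entries. -/
def mkSL (a b c d : ℂ) (h : a * d - b * c = 1) : SL2C :=
  ⟨!![a, b; c, d], by rw [Matrix.det_fin_two_of, h]⟩

@[simp] lemma mkSL_val (a b c d : ℂ) (h : a * d - b * c = 1) :
    (mkSL a b c d h).1 = !![a, b; c, d] := rfl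

lemma mkSL_inv (a b c d : ℂ) (h : a * d - b * c = 1) :
    (mkSL a b c d h)⁻¹ = mkSL d (-b) (-c) a (by linear_combination h) := by
  ext1
  rw [Matrix.SpecialLinearGroup.coe_inv]
  simp [Matrix.adjugate_fin_two]

/-! ### The trace of a commutator -/

lemma trace_mul_adjugate_fin_two (A B : Matrix (Fin 2) (Fin 2) ℂ) :
    (A * B * A.adjugate * B.adjugate).trace =
      A.trace ^ 2 * B.det + B.trace ^ 2 * A.det + (A * B).trace ^ 2
        - A.trace * B.trace * (A * B).trace - 2 * A.det * B.det := by
  simp only [Matrix.adjugate_fin_two, Matrix.trace_fin_two, Matrix.det_fin_two, Matrix.mul_apply,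
    Fin.sum_univ_two]
  simp
  ring

lemma trace_commutator (A B : SL2C) :
    (A * B * A⁻¹ * B⁻¹ : SL2C).1.trace =
      A.1.trace ^ 2 + B.1.trace ^ 2 + (A * B : SL2C).1.trace ^ 2
        - A.1.trace * B.1.trace * (A * B : SL2C).1.trace - 2 := by
  have h := trace_mul_adjugate_fin_two A.1 B.1
  rw [A.2, B.2] at h
  simpa [Matrix.SpecialLinearGroup.coe_inv] using h

/-! ### Common eigenvectors -/

/-- `v` is an eigenvector of `M`, or zero. -/
def PreservesLine (M : Matrix (Fin 2) (Fin 2) ℂ) (v : Fin 2 → ℂ) : Prop := ∃ c : ℂ, M *ᵥ v = c • v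

lemma parallel_of_mulVec_eq_zero {M : Matrix (Fin 2) (Fin 2) ℂ} (hM : M ≠ 0) {v w : Fin 2 → ℂ}
    (hv : v ≠ 0) (hMv : M *ᵥ v = 0) (hMw : M *ᵥ w = 0) : ∃ c : ℂ, w = c • v := by
  have key : v 0 * w 1 = v 1 * w 0 := by
    by_contra hne
    apply hM
    have h0 := congrFun hMv
    have h1 := congrFun hMw
    simp only [Matrix.mulVec, dotProduct, Fin.sum_univ_two, Pi.zero_apply] at h0 h1
    have hd : v 0 * w 1 - v 1 * w 0 ≠ 0 := sub_ne_zero.2 hne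
    ext i j
    fin_cases j
    · apply mul_right_cancel₀ hd
      simp only [Fin.zero_eta, Matrix.zero_apply]
      linear_combination w 1 * h0 i - v 1 * h1 i
    · apply mul_right_cancel₀ hd
      simp only [Fin.mk_one, Matrix.zero_apply]
      linear_combination -w 0 * h0 i + v 0 * h1 i
  by_cases h : v 0 = 0
  · have h1 : v 1 ≠ 0 := by
      intro h1; apply hv; ext i; fin_cases i <;> simp [h, h1]
    refine ⟨w 1 / v 1, ?_⟩
    ext i; fin_cases i
    · have : w 0 = 0 := by
        rw [h, zero_mul] at key
        exact (mul_eq_zero.1 key.symm).resolve_left h1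
      simp [h, this]
    · simp [h1]
  · refine ⟨w 0 / v 0, ?_⟩
    ext i; fin_cases i
    · simp [h]
    · simp; field_simp; linear_combination key

lemma exists_eigenvector (M : Matrix (Fin 2) (Fin 2) ℂ) (s : ℂ)
    (hs : s ^ 2 - M.trace * s + M.det = 0) : ∃ v : Fin 2 → ℂ, v ≠ 0 ∧ M *ᵥ v = s • v := by
  have hdet : (M - s • (1 : Matrix (Fin 2) (Fin 2) ℂ)).det = 0 := by
    rw [← hs]
    simp [Matrix.det_fin_two, Matrix.trace_fin_two]
    ring
  obtain ⟨v, hv, h⟩ := Matrix.exists_mulVec_eq_zero_iff.2 hdet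
  refine ⟨v, hv, ?_⟩
  rw [Matrix.sub_mulVec, Matrix.smul_mulVec, Matrix.one_mulVec, sub_eq_zero] at h
  exact h

lemma exists_quadratic_root (p : ℂ) : ∃ s : ℂ, s ≠ 0 ∧ s ^ 2 - p * s + 1 = 0 := by
  obtain ⟨r, hr⟩ := IsAlgClosed.exists_pow_nat_eq (p ^ 2 / 4 - 1) (n := 2) (by norm_num)
  have h : (p / 2 + r) ^ 2 - p * (p / 2 + r) + 1 = 0 := by linear_combination hr
  refine ⟨p / 2 + r, ?_, h⟩
  intro h0
  rw [h0] at h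
  norm_num at h

lemma exists_eigenvector_SL2C (A : SL2C) :
    ∃ (s : ℂ) (v : Fin 2 → ℂ), s ≠ 0 ∧ s ^ 2 - A.1.trace * s + 1 = 0 ∧ v ≠ 0 ∧
      A.1 *ᵥ v = s • v := by
  obtain ⟨s, hs0, hs⟩ := exists_quadratic_root A.1.trace
  obtain ⟨v, hv, h⟩ := exists_eigenvector A.1 s (by rw [A.2]; exact hs)
  exact ⟨s, v, hs0, hs, hv, h⟩

lemma PreservesLine.inv {A : SL2C} {v : Fin 2 → ℂ} (h : PreservesLine A.1 v) :
    PreservesLine (A⁻¹ : SL2C).1 v := by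
  obtain ⟨c, hc⟩ := h
  have h1 : (A⁻¹ : SL2C).1 *ᵥ (A.1 *ᵥ v) = v := by
    rw [Matrix.mulVec_mulVec, ← Matrix.SpecialLinearGroup.coe_mul]; simp
  by_cases hc0 : c = 0
  · rw [hc, hc0, zero_smul, Matrix.mulVec_zero] at h1
    exact ⟨0, by simp [← h1]⟩
  · refine ⟨c⁻¹, ?_⟩
    rw [hc, Matrix.mulVec_smul] at h1
    rw [← h1, smul_smul, inv_mul_cancel₀ hc0, one_smul, h1]

lemma PreservesLine.mul {A B : Matrix (Fin 2) (Fin 2) ℂ} {v : Fin 2 → ℂ}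
    (hA : PreservesLine A v) (hB : PreservesLine B v) : PreservesLine (A * B) v := by
  obtain ⟨c, hc⟩ := hA
  obtain ⟨d, hd⟩ := hB
  exact ⟨d * c, by rw [← Matrix.mulVec_mulVec, hd, Matrix.mulVec_smul, hc, smul_smul]⟩

/-- The intertwining relation makes `A` preserve the kernel of `M`, which is exactly the line of `v`
because `M ≠ 0`. -/
lemma preservesLine_of_commute_of_kernel {M A A' : Matrix (Fin 2) (Fin 2) ℂ} (hM : M ≠ 0)
    {v : Fin 2 → ℂ} (hv : v ≠ 0) (hMv : M *ᵥ v = 0) (h : M * A = A' * M) : PreservesLine A v := by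
  refine parallel_of_mulVec_eq_zero hM hv hMv ?_
  rw [Matrix.mulVec_mulVec, h, ← Matrix.mulVec_mulVec, hMv, Matrix.mulVec_zero]

/-- With `N = AB - BA` and `adj A = tr A - A`, the first identity reads `AN + NA = tr(A) N`. The
left side is `A²B - BA²`, so this is Cayley–Hamilton. It shows that the inverses of `A` and `B`
preserve the kernel of `N`. -/
lemma sub_commutator_mul_adjugate (A B : Matrix (Fin 2) (Fin 2) ℂ) :
    (A * B - B * A) * A.adjugate = A * (A * B - B * A) ∧
      (A * B - B * A) * B.adjugate = B * (A * B - B * A) := by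
  constructor <;>
  · ext i j
    fin_cases i <;> fin_cases j <;>
      simp [Matrix.adjugate_fin_two, Matrix.mul_apply, Fin.sum_univ_two] <;> ring

/-- For unimodular matrices, `AB - BA = (K - 1) BA` with `K` the group commutator, and `det (K - 1)
= 2 - tr K`. -/
lemma det_sub_commutator (A B : Matrix (Fin 2) (Fin 2) ℂ) :
    (A * B - B * A).det = 2 * A.det * B.det - (A * B * A.adjugate * B.adjugate).trace := by
  simp only [Matrix.adjugate_fin_two, Matrix.trace_fin_two, Matrix.det_fin_two, Matrix.mul_apply,
    Fin.sum_univ_two, Matrix.sub_apply]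
  simp
  ring

/-- Two matrices whose commutator has trace `2` have a common eigenvector. -/
lemma exists_common_eigenvector (A B : SL2C) (h : (A * B * A⁻¹ * B⁻¹ : SL2C).1.trace = 2) :
    ∃ v : Fin 2 → ℂ, v ≠ 0 ∧ PreservesLine A.1 v ∧ PreservesLine B.1 v := by
  have hdet : (A.1 * B.1 - B.1 * A.1).det = 0 := by
    rw [det_sub_commutator, A.2, B.2]
    have h' : (A.1 * B.1 * A.1.adjugate * B.1.adjugate).trace = 2 := by
      simpa [Matrix.SpecialLinearGroup.coe_inv] using h
    rw [h']; norm_num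
  by_cases hN : A.1 * B.1 - B.1 * A.1 = 0
  · obtain ⟨s, v, -, -, hv, hA⟩ := exists_eigenvector_SL2C A
    by_cases hs : A.1 - s • (1 : Matrix (Fin 2) (Fin 2) ℂ) = 0
    · obtain ⟨r, w, -, -, hw, hB⟩ := exists_eigenvector_SL2C B
      refine ⟨w, hw, ⟨s, ?_⟩, ⟨r, hB⟩⟩
      rw [sub_eq_zero.1 hs, Matrix.smul_mulVec, Matrix.one_mulVec]
    · refine ⟨v, hv, ⟨s, hA⟩, preservesLine_of_commute_of_kernel (A' := B.1) hs hv ?_ ?_⟩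
      · rw [Matrix.sub_mulVec, hA, Matrix.smul_mulVec, Matrix.one_mulVec, sub_self]
      · rw [sub_mul, mul_sub, sub_eq_zero.1 hN]; simp
  · obtain ⟨v, hv, hNv⟩ := Matrix.exists_mulVec_eq_zero_iff.2 hdet
    have key := sub_commutator_mul_adjugate A.1 B.1
    refine ⟨v, hv, ?_, ?_⟩
    · have := (show PreservesLine (A⁻¹ : SL2C).1 v by
        rw [Matrix.SpecialLinearGroup.coe_inv]
        exact preservesLine_of_commute_of_kernel hN hv hNv key.1).inv
      simpa using this
    · have := (show PreservesLine (B⁻¹ : SL2C).1 v by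
        rw [Matrix.SpecialLinearGroup.coe_inv]
        exact preservesLine_of_commute_of_kernel hN hv hNv key.2).inv
      simpa using this

lemma trace_eq_two_of_common_eigenvector (A B : SL2C) {v : Fin 2 → ℂ} (hv : v ≠ 0)
    (hA : PreservesLine A.1 v) (hB : PreservesLine B.1 v) :
    (A * B * A⁻¹ * B⁻¹ : SL2C).1.trace = 2 := by
  have h : (A * B * A⁻¹ * B⁻¹ : SL2C).1.trace = 2 - (A.1 * B.1 - B.1 * A.1).det := by
    rw [det_sub_commutator, A.2, B.2]
    simp [Matrix.SpecialLinearGroup.coe_inv]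
  have h0 : (A.1 * B.1 - B.1 * A.1).det = 0 := by
    refine Matrix.exists_mulVec_eq_zero_iff.1 ⟨v, hv, ?_⟩
    obtain ⟨c, hc⟩ := hA
    obtain ⟨d, hd⟩ := hB
    rw [Matrix.sub_mulVec, ← Matrix.mulVec_mulVec, ← Matrix.mulVec_mulVec, hc, hd,
      Matrix.mulVec_smul, Matrix.mulVec_smul, hc, hd, smul_smul, smul_smul, mul_comm, sub_self]
  rw [h, h0, sub_zero]

/-! ### Conjugacy of pairs with equal traces -/

/-- The change of basis `P' P⁻¹` conjugates; dividing by a square root of its determinant puts it in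
`SL(2, ℂ)`. One `g` serves all pairs `A`, `A'`, so it conjugates both generators simultaneously. -/
lemma exists_SL2C_conj {P P' : Matrix (Fin 2) (Fin 2) ℂ} (hP : P.det ≠ 0) (hP' : P'.det ≠ 0) :
    ∃ g : SL2C, ∀ A A' : SL2C, (∃ M, A.1 * P = P * M ∧ A'.1 * P' = P' * M) →
      A' = g * A * g⁻¹ := by
  obtain ⟨r, hr⟩ := IsAlgClosed.exists_pow_nat_eq ((P' * P⁻¹).det) (n := 2) (by norm_num)
  have hd : (P' * P⁻¹).det ≠ 0 := by
    rw [Matrix.det_mul]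
    refine mul_ne_zero hP' ?_
    rw [Matrix.det_nonsing_inv]
    simpa using hP
  have hr0 : r ≠ 0 := by rintro rfl; apply hd; rw [← hr]; norm_num
  obtain ⟨g, hg⟩ : ∃ g : SL2C, g.1 = r⁻¹ • (P' * P⁻¹) :=
    ⟨⟨r⁻¹ • (P' * P⁻¹), by rw [Matrix.det_smul, ← hr, Fintype.card_fin]; field_simp⟩, rfl⟩
  refine ⟨g, ?_⟩
  · rintro A A' ⟨M, hM, hM'⟩
    have hu : IsUnit P.det := hP.isUnit
    rw [eq_mul_inv_iff_mul_eq]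
    ext1
    simp only [Matrix.SpecialLinearGroup.coe_mul, hg, Matrix.mul_smul, Matrix.smul_mul]
    rw [← Matrix.mul_assoc, hM', Matrix.mul_assoc, Matrix.mul_assoc]
    have : M = P⁻¹ * (A.1 * P) := by
      rw [hM, ← Matrix.mul_assoc, Matrix.nonsing_inv_mul _ hu, Matrix.one_mul]
    rw [this, Matrix.mul_assoc, Matrix.mul_assoc, Matrix.mul_nonsing_inv _ hu, Matrix.mul_one]

/-- A normal form for a pair without common eigenvector, depending only on the traces and on an
eigenvalue of the product. -/
lemma exists_basis_normal_form (A B : SL2C) (h : (A * B * A⁻¹ * B⁻¹ : SL2C).1.trace ≠ 2) {s : ℂ}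
    (hs0 : s ≠ 0) (hs : s ^ 2 - (A * B : SL2C).1.trace * s + 1 = 0) :
    ∃ P : Matrix (Fin 2) (Fin 2) ℂ, P.det ≠ 0 ∧
      A.1 * P = P * !![A.1.trace, s; -s⁻¹, 0] ∧ B.1 * P = P * !![0, -1; 1, B.1.trace] := by
  obtain ⟨v, hv, hAB⟩ := exists_eigenvector (A * B : SL2C).1 s
    (by rw [(A * B : SL2C).2]; exact hs)
  have hAB' : A.1 *ᵥ (B.1 *ᵥ v) = s • v := by
    rw [Matrix.mulVec_mulVec]; exact hAB
  have e0 := congrFun hAB' 0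
  have e1 := congrFun hAB' 1
  have dA := det_SL2C A
  have dB := det_SL2C B
  set w := B.1 *ᵥ v with hw
  have w0 := congrFun hw 0
  have w1 := congrFun hw 1
  simp only [Matrix.mulVec, dotProduct, Fin.sum_univ_two, Pi.smul_apply, smul_eq_mul]
    at e0 e1 w0 w1
  -- The basis is `v`, `w = Bv`, where `ABv = sv`. Then `Aw = sv`, and Cayley–Hamilton gives `Av =
  -- tr(A) v - s⁻¹ w` and `Bw = tr(B) w - v`. If `v`, `w` were dependent, `v` would be a common
  -- eigenvector.
  refine ⟨!![v 0, w 0; v 1, w 1], ?_, ?_, ?_⟩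
  · intro hdet
    apply h
    obtain ⟨u, hu, hPu⟩ := Matrix.exists_mulVec_eq_zero_iff.2 hdet
    have f0 := congrFun hPu 0
    have f1 := congrFun hPu 1
    simp [Matrix.mulVec, dotProduct, Fin.sum_univ_two] at f0 f1
    have hu1 : u 1 ≠ 0 := by
      intro hu1
      rw [hu1, mul_zero, add_zero] at f0 f1
      have hu0 : u 0 ≠ 0 := by
        intro hu0; apply hu; ext i; fin_cases i <;> simp [hu0, hu1]
      apply hv
      ext i
      fin_cases i
      · exact (mul_eq_zero.1 f0).resolve_right hu0
      · exact (mul_eq_zero.1 f1).resolve_right hu0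
    have hB : PreservesLine B.1 v := by
      refine ⟨-(u 0 / u 1), ?_⟩
      rw [← hw]
      ext i
      fin_cases i
      · simp; field_simp; linear_combination f0
      · simp; field_simp; linear_combination f1
    have hA : PreservesLine A.1 v := by
      have hP : PreservesLine (A * B : SL2C).1 v := ⟨s, hAB⟩
      have := hP.mul hB.inv
      rw [← Matrix.SpecialLinearGroup.coe_mul] at this
      simpa using this
    exact trace_eq_two_of_common_eigenvector A B hv hA hB
  · ext i j
    fin_cases i <;> fin_cases j <;> simp [Matrix.mul_apply, Fin.sum_univ_two, Matrix.trace_fin_two]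
    · field_simp
      linear_combination A.1 1 1 * e0 - A.1 0 1 * e1 - w 0 * dA
    · linear_combination e0
    · field_simp
      linear_combination -A.1 1 0 * e0 + A.1 0 0 * e1 - w 1 * dA
    · linear_combination e1
  · ext i j
    fin_cases i <;> fin_cases j <;> simp [Matrix.mul_apply, Fin.sum_univ_two, Matrix.trace_fin_two]
    · exact w0.symm
    · linear_combination (-B.1 1 1) * w0 + B.1 0 1 * w1 - v 0 * dB
    · exact w1.symm
    · linear_combination (B.1 1 0) * w0 - B.1 0 0 * w1 - v 1 * dB

/-- Choosing the same eigenvalue `s` of the two products gives both pairs literally the same normal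
form. -/
lemma exists_conj_of_trace_eq {A B A' B' : SL2C}
    (h : (A * B * A⁻¹ * B⁻¹ : SL2C).1.trace ≠ 2)
    (hA : A'.1.trace = A.1.trace) (hB : B'.1.trace = B.1.trace)
    (hAB : (A' * B' : SL2C).1.trace = (A * B : SL2C).1.trace) :
    ∃ g : SL2C, A' = g * A * g⁻¹ ∧ B' = g * B * g⁻¹ := by
  have h' : (A' * B' * A'⁻¹ * B'⁻¹ : SL2C).1.trace ≠ 2 := by
    rwa [trace_commutator, hA, hB, hAB, ← trace_commutator]
  obtain ⟨s, hs0, hs⟩ := exists_quadratic_root (A * B : SL2C).1.trace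
  obtain ⟨P, hP, h1, h2⟩ := exists_basis_normal_form A B h hs0 hs
  obtain ⟨P', hP', h1', h2'⟩ := exists_basis_normal_form A' B' h' hs0 (by rw [hAB]; exact hs)
  obtain ⟨g, hg⟩ := exists_SL2C_conj hP hP'
  rw [hA] at h1'
  rw [hB] at h2'
  exact ⟨g, hg _ _ ⟨_, h1, h1'⟩, hg _ _ ⟨_, h2, h2'⟩⟩

lemma exists_pair_with_traces (x y z : ℂ) : ∃ A B : SL2C,
    A.1.trace = x ∧ B.1.trace = y ∧ (A * B : SL2C).1.trace = z := by
  obtain ⟨t, ht0, ht⟩ := exists_quadratic_root z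
  -- The product of these matrices is triangular with diagonal `t⁻¹`, `t`, and `t` is chosen so that
  -- `t + t⁻¹ = z`.
  refine ⟨mkSL x (-1) 1 0 (by ring), mkSL 0 t (-t⁻¹) y (by field_simp; ring), ?_, ?_, ?_⟩
  · simp [Matrix.trace_fin_two]
  · simp [Matrix.trace_fin_two]
  · simp [Matrix.trace_fin_two]
    field_simp
    linear_combination ht

lemma exists_triangular_conj (A : SL2C) {r : ℂ} (hr0 : r ≠ 0) (hr : A.1.trace = r + r⁻¹) :
    ∃ (g M : SL2C) (s : ℂ), M.1 = !![r, s; 0, r⁻¹] ∧ A = g * M * g⁻¹ := by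
  obtain ⟨v, hv, h⟩ := exists_eigenvector A.1 r (by rw [hr, A.2]; field_simp; ring)
  obtain ⟨w, hw⟩ : ∃ w : Fin 2 → ℂ, v 0 * w 1 - w 0 * v 1 = 1 := by
    by_cases h0 : v 0 = 0
    · have h1 : v 1 ≠ 0 := by
        intro h1; apply hv; ext i; fin_cases i <;> simp [h0, h1]
      exact ⟨![-(v 1)⁻¹, 0], by simp [h1]⟩
    · exact ⟨![0, (v 0)⁻¹], by simp [h0]⟩
  have e0 := congrFun h 0
  have e1 := congrFun h 1
  simp only [Matrix.mulVec, dotProduct, Fin.sum_univ_two, Pi.smul_apply, smul_eq_mul] at e0 e1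
  rw [Matrix.trace_fin_two] at hr
  obtain ⟨g, hg⟩ : ∃ g, g = mkSL (v 0) (w 0) (v 1) (w 1) hw := ⟨_, rfl⟩
  refine ⟨g, g⁻¹ * A * g, (g⁻¹ * A * g).1 0 1, ?_, by group⟩
  ext i j
  fin_cases i <;> fin_cases j <;>
    simp [hg, mkSL_inv, Matrix.vecMul, dotProduct, Fin.sum_univ_two, Matrix.mul_apply]
  · linear_combination w 1 * e0 - w 0 * e1 + r * hw
  · linear_combination v 0 * e1 - v 1 * e0
  · linear_combination (A.1 0 0 + A.1 1 1) * hw + hr - w 1 * e0 + w 0 * e1 - r * hw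

/-! ### Parabolic elements -/

lemma isParabolic_of_toPSL {A : SL2C} (h : IsParabolicElt (toPSL A)) : A.1.IsParabolic := by
  obtain ⟨B, hB, hp⟩ := h
  rcases toPSL_eq_iff.1 hB with rfl | rfl
  · exact hp
  · rw [Matrix.SpecialLinearGroup.coe_neg] at hp
    exact hp.of_neg

lemma trace_sq_of_isParabolic {A : SL2C} (h : A.1.IsParabolic) : A.1.trace ^ 2 = 4 := by
  have := h.2
  rw [Matrix.discr_fin_two, A.2] at this
  linear_combination this

lemma isParabolic_of_trace_eq_neg_two {K : SL2C} (h : K.1.trace = -2) (hK : K ≠ -1) :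
    K.1.IsParabolic := by
  constructor
  · rintro ⟨c, hc⟩
    apply hK
    rw [← hc, Matrix.trace_fin_two] at h
    have : c = -1 := by simp at h; linear_combination h / 2
    ext1
    rw [← hc, this, Matrix.SpecialLinearGroup.coe_neg, Matrix.SpecialLinearGroup.coe_one, map_neg,
      map_one]
  · rw [Matrix.discr_fin_two, K.2, h]; norm_num

lemma isParabolic_conj_zpow {K : SL2C} (h : K.1.trace = -2) (hK : K ≠ -1) (g : SL2C) {n : ℤ}
    (hn : n ≠ 0) : (g * K ^ n * g⁻¹ : SL2C).1.IsParabolic := by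
  have key : ∀ L : SL2C, L.1.trace = -2 → L ≠ -1 → ∀ m : ℕ, m ≠ 0 →
      (g * L ^ m * g⁻¹ : SL2C).1.IsParabolic := by
    intro L hL hL1 m hm
    have h1 : (Matrix.SpecialLinearGroup.toGL L).IsParabolic :=
      isParabolic_of_trace_eq_neg_two hL hL1
    have h2 := (Matrix.GeneralLinearGroup.isParabolic_conj_iff
      (Matrix.SpecialLinearGroup.toGL g) _).2 (h1.pow hm)
    rw [← map_inv, ← map_pow, ← map_mul, ← map_mul] at h2
    exact h2
  obtain ⟨m, rfl | rfl⟩ := n.eq_nat_or_neg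
  · rw [zpow_natCast]
    exact key K h hK m (by simpa using hn)
  · rw [_root_.zpow_neg, zpow_natCast, ← inv_pow]
    refine key K⁻¹ (by rw [trace_inv_SL2C, h]) ?_ m (by simpa using hn)
    intro h1
    apply hK
    rw [← inv_inv K, h1]
    exact inv_eq_of_mul_eq_one_right (by simp)

lemma trace_mul_comm_SL2C (A B : SL2C) : (A * B : SL2C).1.trace = (B * A : SL2C).1.trace :=
  Matrix.trace_mul_comm A.1 B.1

lemma trace_conj_SL2C (g A : SL2C) : (g * A * g⁻¹ : SL2C).1.trace = A.1.trace := by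
  rw [trace_mul_comm_SL2C, inv_mul_cancel_left]

/-- If the commutator were `-1`, then `A` would be conjugate to `-A`. This is where `x ≠ 0` enters:
trace `-2` alone does not exclude a commutator trivial in `PSL(2, ℂ)`. -/
lemma commutator_ne_neg_one {A B : SL2C} (h : A.1.trace ≠ 0) : A * B * A⁻¹ * B⁻¹ ≠ -1 := by
  intro hK
  apply h
  have h1 : A = -(B * A * B⁻¹) := by
    calc A = (A * B * A⁻¹ * B⁻¹) * (B * A * B⁻¹) := by group
      _ = -(B * A * B⁻¹) := by rw [hK, neg_mul, one_mul]
  have h2 : A.1.trace = -A.1.trace := by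
    conv_lhs => rw [h1, Matrix.SpecialLinearGroup.coe_neg, Matrix.trace_neg, trace_conj_SL2C]
  linear_combination h2 / 2

/-! ### Lifts of representations -/

/-- The representation in `SL(2, ℂ)` with the given images of the generators. -/
def liftRep (A B : SL2C) : Pi1 →* SL2C := FreeGroup.lift ![A, B]

@[simp] lemma liftRep_genA (A B : SL2C) : liftRep A B genA = A := by simp [liftRep, genA]

@[simp] lemma liftRep_genB (A B : SL2C) : liftRep A B genB = B := by simp [liftRep, genB]

lemma hom_ext_gens {G : Type*} [Group G] {f g : Pi1 →* G} (hA : f genA = g genA)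
    (hB : f genB = g genB) : f = g := by
  ext i
  fin_cases i
  · exact hA
  · exact hB

lemma rep_eq_toPSL_liftRep {ρ : Pi1 →* PSL2C} {A B : SL2C} (hA : toPSL A = ρ genA)
    (hB : toPSL B = ρ genB) (w : Pi1) : ρ w = toPSL (liftRep A B w) := by
  have : ρ = toPSL.comp (liftRep A B) := hom_ext_gens (by simp [hA]) (by simp [hB])
  rw [this]; rfl

lemma preservesLine_liftRep {A B : SL2C} {v : Fin 2 → ℂ} (hA : PreservesLine A.1 v)
    (hB : PreservesLine B.1 v) (w : Pi1) : PreservesLine (liftRep A B w).1 v := by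
  have hof : ∀ i : Fin 2, PreservesLine (liftRep A B (FreeGroup.of i)).1 v := by
    intro i
    fin_cases i
    · change PreservesLine (liftRep A B genA).1 v
      rwa [liftRep_genA]
    · change PreservesLine (liftRep A B genB).1 v
      rwa [liftRep_genB]
  induction w using FreeGroup.induction_on with
  | C1 => exact ⟨1, by simp⟩
  | of i => exact hof i
  | inv_of i _ => rw [map_inv]; exact (hof i).inv
  | mul x y hx hy => rw [map_mul]; exact hx.mul hy

lemma PreservesLine.neg {M : Matrix (Fin 2) (Fin 2) ℂ} {v : Fin 2 → ℂ} (h : PreservesLine M v) :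
    PreservesLine (-M) v := by
  obtain ⟨c, hc⟩ := h
  exact ⟨-c, by rw [Matrix.neg_mulVec, hc, neg_smul]⟩

lemma IrrRep.trace_commutator_ne_two (ρ : IrrRep) {A B : SL2C} (hA : toPSL A = ρ.1 genA)
    (hB : toPSL B = ρ.1 genB) : (A * B * A⁻¹ * B⁻¹ : SL2C).1.trace ≠ 2 := by
  intro h
  obtain ⟨v, hv, hAv, hBv⟩ := exists_common_eigenvector A B h
  refine ρ.2.2 ⟨v, hv, fun w C hC => ?_⟩
  rw [rep_eq_toPSL_liftRep hA hB] at hC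
  have h1 := preservesLine_liftRep hAv hBv w
  rcases toPSL_eq_iff.1 hC with rfl | rfl
  · exact h1
  · rw [Matrix.SpecialLinearGroup.coe_neg]; exact h1.neg

/-- Parabolicity gives `±2`, and irreducibility rules out `2`. The trace does not depend on the
lifts, since signs cancel in a commutator. -/
lemma IrrRep.trace_commutator_eq (ρ : IrrRep) {A B : SL2C} (hA : toPSL A = ρ.1 genA)
    (hB : toPSL B = ρ.1 genB) : (A * B * A⁻¹ * B⁻¹ : SL2C).1.trace = -2 := by
  have h1 : IsPeripheral (genA * genB * genA⁻¹ * genB⁻¹) := ⟨1, 1, one_ne_zero, by simp⟩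
  have h2 := ρ.2.1 _ h1
  rw [map_mul, map_mul, map_mul, map_inv, map_inv, ← hA, ← hB, ← map_inv, ← map_inv, ← map_mul,
    ← map_mul, ← map_mul] at h2
  have h3 := trace_sq_of_isParabolic (isParabolic_of_toPSL h2)
  have h4 : ((A * B * A⁻¹ * B⁻¹ : SL2C).1.trace - 2) *
      ((A * B * A⁻¹ * B⁻¹ : SL2C).1.trace + 2) = 0 := by linear_combination h3
  rcases mul_eq_zero.1 h4 with h5 | h5
  · exact absurd (sub_eq_zero.1 h5) (ρ.trace_commutator_ne_two hA hB)
  · exact eq_neg_of_add_eq_zero_left h5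

lemma IrrRep.markov (ρ : IrrRep) {A B : SL2C} (hA : toPSL A = ρ.1 genA)
    (hB : toPSL B = ρ.1 genB) :
    A.1.trace ^ 2 + B.1.trace ^ 2 + (A * B : SL2C).1.trace ^ 2 =
      A.1.trace * B.1.trace * (A * B : SL2C).1.trace := by
  have h := ρ.trace_commutator_eq hA hB
  rw [trace_commutator] at h
  linear_combination h

/-- Trace `-2` serves twice: the commutator is parabolic, so its nonzero powers are too, and a
common eigenvector would make the trace `2`. -/
lemma exists_irrRep_of_pair {A B : SL2C} (hA : A.1.trace ≠ 0)
    (h : (A * B * A⁻¹ * B⁻¹ : SL2C).1.trace = -2) :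
    ∃ ρ : IrrRep, toPSL A = ρ.1 genA ∧ toPSL B = ρ.1 genB := by
  refine ⟨⟨toPSL.comp (liftRep A B), ?_, ?_⟩, by simp, by simp⟩
  · rintro w ⟨g, n, hn, rfl⟩
    refine ⟨liftRep A B g * (A * B * A⁻¹ * B⁻¹) ^ n * (liftRep A B g)⁻¹, ?_,
      isParabolic_conj_zpow h (commutator_ne_neg_one hA) _ hn⟩
    simp
  · rintro ⟨v, hv, hw⟩
    have h2 := trace_eq_two_of_common_eigenvector A B hv (hw genA A (by simp)) (hw genB B (by simp))
    rw [h] at h2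
    norm_num at h2

/-! ### Trace coordinates -/

lemma exists_hasTraceCoords {x y z : ℂ} (hx : x ≠ 0) (h : x ^ 2 + y ^ 2 + z ^ 2 = x * y * z) :
    ∃ c : CharVar, HasTraceCoords c x y z := by
  obtain ⟨A, B, rfl, rfl, rfl⟩ := exists_pair_with_traces x y z
  obtain ⟨ρ, hA, hB⟩ := exists_irrRep_of_pair (A := A) (B := B) hx (by
    rw [trace_commutator]; linear_combination h)
  exact ⟨Quotient.mk conjSetoid ρ, ρ, rfl, A, B, hA, hB, rfl, rfl, rfl⟩

lemma HasTraceCoords.unique {c c' : CharVar} {x y z : ℂ} (h : HasTraceCoords c x y z)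
    (h' : HasTraceCoords c' x y z) : c = c' := by
  obtain ⟨ρ, rfl, A, B, hA, hB, hx, hy, hz⟩ := h
  obtain ⟨σ, rfl, A', B', hA', hB', hx', hy', hz'⟩ := h'
  obtain ⟨g, hg1, hg2⟩ := exists_conj_of_trace_eq (ρ.trace_commutator_ne_two hA hB)
    (hx'.trans hx.symm) (hy'.trans hy.symm) (hz'.trans hz.symm)
  refine Quotient.sound ⟨toPSL g, fun w => ?_⟩
  have : σ.1 = (MulAut.conj (toPSL g)).toMonoidHom.comp ρ.1 := by
    apply hom_ext_gens
    · rw [← hA', hg1]; simp [hA]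
    · rw [← hB', hg2]; simp [hB]
  rw [this]
  simp

/-- After conjugation, two lifts of the same element of `PSL(2, ℂ)` differ by a sign, chosen
independently for `a` and `b`; the sign for `ab` is the product. -/
lemma HasTraceCoords.sign_unique {c : CharVar} {x y z x' y' z' : ℂ}
    (h : HasTraceCoords c x y z) (h' : HasTraceCoords c x' y' z') :
    ∃ ε δ : ℂ, (ε = 1 ∨ ε = -1) ∧ (δ = 1 ∨ δ = -1) ∧
      x' = ε * x ∧ y' = δ * y ∧ z' = ε * δ * z := by
  obtain ⟨ρ, rfl, A, B, hA, hB, rfl, rfl, rfl⟩ := h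
  obtain ⟨σ, hσ, A', B', hA', hB', rfl, rfl, rfl⟩ := h'
  obtain ⟨g, hg⟩ := Quotient.exact hσ.symm
  obtain ⟨G, rfl⟩ := toPSL_surjective g
  have lift : ∀ {C C' : SL2C} {w : Pi1}, toPSL C = ρ.1 w → toPSL C' = σ.1 w →
      ∃ ε : ℂ, (ε = 1 ∨ ε = -1) ∧ C'.1 = ε • (G * C * G⁻¹ : SL2C).1 := by
    intro C C' w h1 h2
    rw [hg, ← h1, ← map_inv, ← map_mul, ← map_mul, toPSL_eq_iff] at h2
    rcases h2 with rfl | rfl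
    · exact ⟨1, Or.inl rfl, by rw [one_smul]⟩
    · exact ⟨-1, Or.inr rfl, by rw [Matrix.SpecialLinearGroup.coe_neg, neg_smul, one_smul]⟩
  obtain ⟨ε, hε, h1⟩ := lift hA hA'
  obtain ⟨δ, hδ, h2⟩ := lift hB hB'
  refine ⟨ε, δ, hε, hδ, ?_, ?_, ?_⟩
  · rw [h1, Matrix.trace_smul, trace_conj_SL2C, smul_eq_mul]
  · rw [h2, Matrix.trace_smul, trace_conj_SL2C, smul_eq_mul]
  · rw [Matrix.SpecialLinearGroup.coe_mul, h1, h2, Matrix.smul_mul, Matrix.mul_smul, smul_smul,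
      Matrix.trace_smul, ← Matrix.SpecialLinearGroup.coe_mul, smul_eq_mul]
    rw [← trace_conj_SL2C G (A * B), show G * A * G⁻¹ * (G * B * G⁻¹) = G * (A * B) * G⁻¹ by
      simp only [mul_assoc, inv_mul_cancel_left]]

lemma HasTraceCoords.neg_right {c : CharVar} {x y z : ℂ} (h : HasTraceCoords c x y z) :
    HasTraceCoords c x (-y) (-z) := by
  obtain ⟨ρ, rfl, A, B, hA, hB, rfl, rfl, rfl⟩ := h
  refine ⟨ρ, rfl, A, -B, hA, by rw [toPSL_neg, hB], rfl, ?_, ?_⟩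
  · rw [Matrix.SpecialLinearGroup.coe_neg, Matrix.trace_neg]
  · rw [mul_neg, Matrix.SpecialLinearGroup.coe_neg, Matrix.trace_neg]

lemma HasTraceCoords.markov {c : CharVar} {x y z : ℂ} (h : HasTraceCoords c x y z) :
    x ^ 2 + y ^ 2 + z ^ 2 = x * y * z := by
  obtain ⟨ρ, rfl, A, B, hA, hB, rfl, rfl, rfl⟩ := h
  exact ρ.markov hA hB

/-! ### Hyperbolic functions in the half-plane -/

lemma norm_exp_half_gt_one {l : ℂ} (hl : 0 < l.re) : 1 < ‖Complex.exp (l / 2)‖ := by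
  rw [Complex.norm_exp, Real.one_lt_exp_iff]
  simpa using hl

lemma exp_half_sq (l : ℂ) : Complex.exp (l / 2) ^ 2 = Complex.exp l := by
  rw [← Complex.exp_nat_mul]; congr 1; push_cast; ring

lemma sq_sub_one_ne_zero {E : ℂ} (hE : 1 < ‖E‖) : E ^ 2 - 1 ≠ 0 := by
  intro h
  have h1 : ‖E‖ ^ 2 = 1 := by rw [← norm_pow, sub_eq_zero.1 h, norm_one]
  nlinarith

lemma sq_add_one_ne_zero {E : ℂ} (hE : 1 < ‖E‖) : E ^ 2 + 1 ≠ 0 := by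
  intro h
  have h1 : ‖E‖ ^ 2 = 1 := by
    rw [← norm_pow, eq_neg_of_add_eq_zero_left h, norm_neg, norm_one]
  nlinarith

lemma exists_exp_eq_in_strip (b₀ : ℝ) {w : ℂ} (hw : w ≠ 0) :
    ∃ t : ℂ, b₀ ≤ t.im ∧ t.im < b₀ + 2 * Real.pi ∧ Complex.exp t = w := by
  obtain ⟨m, hm, -⟩ := existsUnique_add_zsmul_mem_Ico Real.two_pi_pos (Complex.log w).im b₀
  refine ⟨Complex.log w + m * (2 * Real.pi * Complex.I), ?_, ?_, ?_⟩
  · simpa using hm.1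
  · simpa using hm.2
  · rw [Complex.exp_add, Complex.exp_int_mul_two_pi_mul_I, mul_one, Complex.exp_log hw]

lemma eq_of_exp_eq_in_strip {b₀ : ℝ} {s t : ℂ} (hs : b₀ ≤ s.im) (hs' : s.im < b₀ + 2 * Real.pi)
    (ht : b₀ ≤ t.im) (ht' : t.im < b₀ + 2 * Real.pi) (h : Complex.exp s = Complex.exp t) :
    s = t := by
  obtain ⟨n, hn⟩ := Complex.exp_eq_exp_iff_exists_int.1 h
  have him : s.im = t.im + n * (2 * Real.pi) := by rw [hn]; simp
  have hpi := Real.two_pi_pos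
  have h1 : (n : ℝ) < 1 := by
    by_contra! h1
    nlinarith
  have h2 : (-1 : ℝ) < n := by
    by_contra! h2
    nlinarith
  have h3 : n = 0 := by
    have h1' : n < 1 := by exact_mod_cast h1
    have h2' : -1 < n := by exact_mod_cast h2
    omega
  rw [hn, h3]; simp

/-! ### The Fenchel–Nielsen coordinates -/

/-- The second Fenchel–Nielsen trace coordinate, as a function of the exponentials
`E = exp (l / 2)` and `T = exp (t / 2)`. -/
def fnY (E T : ℂ) : ℂ := (T + T⁻¹) * (E + E⁻¹) / (E - E⁻¹)

/-- The third Fenchel–Nielsen trace coordinate, in terms of the same exponentials. -/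
def fnZ (E T : ℂ) : ℂ := (T * E + (T * E)⁻¹) * (E + E⁻¹) / (E - E⁻¹)

lemma two_cosh_half (l : ℂ) :
    2 * Complex.cosh (l / 2) = Complex.exp (l / 2) + (Complex.exp (l / 2))⁻¹ := by
  rw [Complex.cosh, ← Complex.exp_neg]; ring

lemma two_cosh_div_tanh_half (l s : ℂ) :
    2 * Complex.cosh s / Complex.tanh (l / 2) =
      (Complex.exp s + (Complex.exp s)⁻¹) *
        (Complex.exp (l / 2) + (Complex.exp (l / 2))⁻¹) /
        (Complex.exp (l / 2) - (Complex.exp (l / 2))⁻¹) := by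
  rw [Complex.tanh, div_div_eq_mul_div, Complex.cosh, Complex.cosh, Complex.sinh,
    ← Complex.exp_neg, ← Complex.exp_neg]
  rw [show 2 * ((Complex.exp s + Complex.exp (-s)) / 2) *
      ((Complex.exp (l / 2) + Complex.exp (-(l / 2))) / 2) =
      ((Complex.exp s + Complex.exp (-s)) *
      (Complex.exp (l / 2) + Complex.exp (-(l / 2)))) / 2 by ring,
    div_div_div_cancel_right₀ two_ne_zero]

lemma fnY_eq (l t : ℂ) : 2 * Complex.cosh (t / 2) / Complex.tanh (l / 2) =
    fnY (Complex.exp (l / 2)) (Complex.exp (t / 2)) :=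
  two_cosh_div_tanh_half l (t / 2)

lemma fnZ_eq (l t : ℂ) : 2 * Complex.cosh ((t + l) / 2) / Complex.tanh (l / 2) =
    fnZ (Complex.exp (l / 2)) (Complex.exp (t / 2)) := by
  rw [two_cosh_div_tanh_half, add_div, Complex.exp_add]; rfl

lemma fn_markov {E T : ℂ} (hE : 1 < ‖E‖) (hT : T ≠ 0) :
    (E + E⁻¹) ^ 2 + fnY E T ^ 2 + fnZ E T ^ 2 = (E + E⁻¹) * fnY E T * fnZ E T := by
  have hE0 : E ≠ 0 := by rintro rfl; norm_num at hE
  have h1 : E ^ 2 - 1 ≠ 0 := sq_sub_one_ne_zero hE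
  have h2 : E - E⁻¹ ≠ 0 := by
    intro h; apply h1; field_simp at h; simpa using h
  unfold fnY fnZ
  field_simp
  ring

lemma add_inv_ne_zero {E : ℂ} (hE : 1 < ‖E‖) : E + E⁻¹ ≠ 0 := by
  have hE0 : E ≠ 0 := by rintro rfl; norm_num at hE
  have h1 := sq_add_one_ne_zero hE
  intro h; apply h1; field_simp at h; simpa using h

/-- One linear factor of the conic recovers `T` from `(y, z)`, since `E + E⁻¹ ≠ 0`; injectivity in
`t` rests on this. -/
lemma fn_recover {E T : ℂ} (hE : 1 < ‖E‖) (hT : T ≠ 0) :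
    fnZ E T - E⁻¹ * fnY E T = T * (E + E⁻¹) := by
  have hE0 : E ≠ 0 := by rintro rfl; norm_num at hE
  have h1 : E ^ 2 - 1 ≠ 0 := sq_sub_one_ne_zero hE
  unfold fnY fnZ
  field_simp
  ring

/-- Every solution of the Markov equation with first coordinate `E + E⁻¹` is given by
Fenchel–Nielsen coordinates. -/
lemma exists_fn_param {E y z : ℂ} (hE : 1 < ‖E‖)
    (h : (E + E⁻¹) ^ 2 + y ^ 2 + z ^ 2 = (E + E⁻¹) * y * z) :
    ∃ T : ℂ, T ≠ 0 ∧ y = fnY E T ∧ z = fnZ E T := by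
  have hE0 : E ≠ 0 := by rintro rfl; norm_num at hE
  have h1 : E ^ 2 - 1 ≠ 0 := sq_sub_one_ne_zero hE
  have h3 : E ^ 2 + 1 ≠ 0 := sq_add_one_ne_zero hE
  have hx := add_inv_ne_zero hE
  have h2 : E - E⁻¹ ≠ 0 := by
    intro h; apply h1; field_simp at h; simpa using h
  have hEi : E * E⁻¹ = 1 := mul_inv_cancel₀ hE0
  -- The Markov equation factored as `(z - E⁻¹ y)(E y - z) = x²`; the two normalized factors are `T`
  -- and `T⁻¹`.
  have hTS : (z - E⁻¹ * y) / (E + E⁻¹) * ((E * y - z) / (E + E⁻¹)) = 1 := by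
    rw [div_mul_div_comm, div_eq_one_iff_eq (mul_ne_zero hx hx)]
    linear_combination -h - y ^ 2 * hEi
  have hT : (z - E⁻¹ * y) / (E + E⁻¹) ≠ 0 := left_ne_zero_of_mul_eq_one hTS
  refine ⟨_, hT, ?_, ?_⟩
  · rw [fnY, ← eq_inv_of_mul_eq_one_right hTS]
    field_simp
    ring
  · rw [fnZ, mul_inv, ← eq_inv_of_mul_eq_one_right hTS]
    field_simp
    ring

lemma fnY_neg (E T : ℂ) : fnY E (-T) = -fnY E T := by
  simp only [fnY, inv_neg]; ring

lemma fnZ_neg (E T : ℂ) : fnZ E (-T) = -fnZ E T := by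
  simp only [fnZ, neg_mul, inv_neg]; ring

/-- The equation factors as `(F - εE)(FE - ε) = 0`, and `FE = ε` is impossible for two numbers of
modulus greater than one. -/
lemma sq_eq_sq_of_add_inv_eq {E F ε : ℂ} (hE : 1 < ‖E‖) (hF : 1 < ‖F‖)
    (hε : ε = 1 ∨ ε = -1) (h : F + F⁻¹ = ε * (E + E⁻¹)) : F ^ 2 = E ^ 2 := by
  have hE0 : E ≠ 0 := by rintro rfl; norm_num at hE
  have hF0 : F ≠ 0 := by rintro rfl; norm_num at hF
  have hε2 : ε ^ 2 = 1 := by rcases hε with rfl | rfl <;> norm_num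
  have h1 : (F - ε * E) * (F * E - ε) = 0 := by
    field_simp at h
    linear_combination h + F * E * hε2 - F * E * hε2 + E * hε2
  rcases mul_eq_zero.1 h1 with h2 | h2
  · rw [sub_eq_zero.1 h2, mul_pow, hε2, one_mul]
  · exfalso
    have h3 : ‖F‖ * ‖E‖ = 1 := by
      rw [← norm_mul, sub_eq_zero.1 h2]
      rcases hε with rfl | rfl <;> simp
    nlinarith

/-! ### The Fenchel–Nielsen map -/

lemma exists_fn_class {l : ℂ} (hl : 0 < l.re) (t : ℂ) : ∃ c : CharVar,
    HasTraceCoords c (Complex.exp (l / 2) + (Complex.exp (l / 2))⁻¹)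
      (fnY (Complex.exp (l / 2)) (Complex.exp (t / 2)))
      (fnZ (Complex.exp (l / 2)) (Complex.exp (t / 2))) :=
  exists_hasTraceCoords (add_inv_ne_zero (norm_exp_half_gt_one hl))
    (fn_markov (norm_exp_half_gt_one hl) (Complex.exp_ne_zero _))

/-- The complex Fenchel–Nielsen map. -/
def fnMap (b₀ : ℝ) (p : fnDomain b₀) : CharVar := (exists_fn_class p.2.1 p.1.2).choose

lemma fnMap_spec (b₀ : ℝ) (p : fnDomain b₀) :
    HasTraceCoords (fnMap b₀ p) (Complex.exp (p.1.1 / 2) + (Complex.exp (p.1.1 / 2))⁻¹)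
      (fnY (Complex.exp (p.1.1 / 2)) (Complex.exp (p.1.2 / 2)))
      (fnZ (Complex.exp (p.1.1 / 2)) (Complex.exp (p.1.2 / 2))) :=
  (exists_fn_class p.2.1 p.1.2).choose_spec

lemma fnMap_injective (b₀ : ℝ) : Function.Injective (fnMap b₀) := by
  rintro ⟨⟨l, t⟩, hl, hl1, hl2, ht1, ht2⟩ ⟨⟨l', t'⟩, hl', hl1', hl2', ht1', ht2'⟩ h
  have h1 := fnMap_spec b₀ ⟨⟨l, t⟩, hl, hl1, hl2, ht1, ht2⟩
  have h2 := fnMap_spec b₀ ⟨⟨l', t'⟩, hl', hl1', hl2', ht1', ht2'⟩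
  rw [← h] at h2
  obtain ⟨ε, δ, hε, hδ, hx, hy, hz⟩ := h1.sign_unique h2
  have hE := norm_exp_half_gt_one hl
  have hll : l = l' := by
    apply Complex.exp_inj_of_neg_pi_lt_of_le_pi hl1 hl2 hl1' hl2'
    rw [← exp_half_sq l, ← exp_half_sq l']
    exact (sq_eq_sq_of_add_inv_eq hE (norm_exp_half_gt_one hl') hε hx).symm
  subst hll
  have hx0 := add_inv_ne_zero hE
  -- Once `l = l'` the first coordinates agree and are nonzero, so only the sign `δ` is left.
  have hε1 : ε = 1 := by
    have := mul_right_cancel₀ hx0 ((one_mul _).trans hx)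
    exact this.symm
  rw [hε1, one_mul] at hz
  have r1 := fn_recover hE (Complex.exp_ne_zero (t / 2))
  have r2 := fn_recover hE (Complex.exp_ne_zero (t' / 2))
  rw [hy, hz] at r2
  have hT : Complex.exp (t' / 2) = δ * Complex.exp (t / 2) := by
    apply mul_right_cancel₀ hx0
    linear_combination δ * r1 - r2
  -- The remaining sign `δ` turns `T` into `±T` and disappears in `T² = exp t`.
  have htt : t = t' := by
    apply eq_of_exp_eq_in_strip ht1 ht2 ht1' ht2'
    rw [← exp_half_sq t, ← exp_half_sq t', hT, mul_pow]
    rcases hδ with rfl | rfl <;> norm_num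
  subst htt
  rfl

lemma exists_fnMap_eq (b₀ : ℝ) {l : ℂ} (hl : 0 < l.re) (hl1 : -Real.pi < l.im)
    (hl2 : l.im ≤ Real.pi) {c : CharVar} (hc : c ∈ linearSlice l) :
    ∃ p : fnDomain b₀, p.1.1 = l ∧ fnMap b₀ p = c := by
  obtain ⟨ρ, rfl, -, M, s, hM, hconj⟩ := hc
  obtain ⟨g, hg⟩ := isConj_iff.1 hconj.symm
  obtain ⟨G, rfl⟩ := toPSL_surjective g
  obtain ⟨B, hB⟩ := toPSL_surjective (ρ.1 genB)
  have hA : toPSL (G * M * G⁻¹) = ρ.1 genA := by rw [← hg]; simp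
  have hE := norm_exp_half_gt_one hl
  have htr : (G * M * G⁻¹ : SL2C).1.trace = Complex.exp (l / 2) + (Complex.exp (l / 2))⁻¹ := by
    rw [trace_conj_SL2C, hM, Matrix.trace_fin_two_of, ← Complex.exp_neg, neg_div]
  have hcoords : HasTraceCoords (Quotient.mk conjSetoid ρ) _ _ _ :=
    ⟨ρ, rfl, G * M * G⁻¹, B, hA, hB, htr, rfl, rfl⟩
  obtain ⟨T, hT, hy, hz⟩ := exists_fn_param hE hcoords.markov
  rw [hy, hz] at hcoords
  obtain ⟨t, ht1, ht2, ht⟩ := exists_exp_eq_in_strip b₀ (pow_ne_zero 2 hT)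
  refine ⟨⟨⟨l, t⟩, hl, hl1, hl2, ht1, ht2⟩, rfl, ?_⟩
  have hspec := fnMap_spec b₀ ⟨⟨l, t⟩, hl, hl1, hl2, ht1, ht2⟩
  rw [← exp_half_sq t] at ht
  -- Only `exp t = T²` was arranged, so `exp (t / 2)` may be `-T`; this amounts to changing the sign
  -- of the lift of `ρ(b)`.
  rcases sq_eq_sq_iff_eq_or_eq_neg.1 ht with h | h
  · rw [h] at hspec
    exact hspec.unique hcoords
  · rw [h, fnY_neg, fnZ_neg] at hspec
    exact hspec.unique hcoords.neg_right

lemma hasComplexLength_of_trace {A : SL2C} {l : ℂ} (hl : 0 ≤ l.re)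
    (h : A.1.trace = Complex.exp (l / 2) + (Complex.exp (l / 2))⁻¹) :
    HasComplexLength (toPSL A) l := by
  obtain ⟨g, M, s, hM, hA⟩ := exists_triangular_conj A (Complex.exp_ne_zero (l / 2)) h
  refine ⟨hl, M, s, ?_, ?_⟩
  · rw [hM, neg_div, Complex.exp_neg]
  · rw [hA]
    exact (isConj_iff.2 ⟨toPSL g, by simp⟩ : IsConj (toPSL M) (toPSL (g * M * g⁻¹))).symm

lemma fnMap_mem_linearSlice (b₀ : ℝ) (p : fnDomain b₀) : fnMap b₀ p ∈ linearSlice p.1.1 := by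
  obtain ⟨ρ, hρ, A, B, hA, hB, hx, -, -⟩ := fnMap_spec b₀ p
  refine ⟨ρ, hρ, ?_⟩
  rw [← hA]
  exact hasComplexLength_of_trace p.2.1.le hx

/-- A class whose representations send the generator `a` to an element with trace outside
`[-2, 2]` is in the image of the Fenchel–Nielsen map. -/
lemma mem_range_fnMap (b₀ : ℝ) (ρ : IrrRep) {A : SL2C} (hA : toPSL A = ρ.1 genA)
    (h : ∀ θ : ℝ, A.1.trace ≠ 2 * Real.cos θ) :
    Quotient.mk conjSetoid ρ ∈ Set.range (fnMap b₀) := by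
  obtain ⟨r, hr0, hr⟩ := exists_quadratic_root A.1.trace
  have hr' : A.1.trace = r + r⁻¹ := by field_simp; linear_combination -hr
  have hnorm : ‖r‖ ≠ 1 := by
    intro h1
    apply h r.arg
    have h2 : r = Complex.exp (r.arg * Complex.I) := by
      conv_lhs => rw [← Complex.norm_mul_exp_arg_mul_I r, h1]
      simp
    rw [hr', Complex.ofReal_cos, Complex.cos]
    conv_lhs => rw [h2]
    rw [← Complex.exp_neg]
    ring_nf
  -- The eigenvalues are `r` and `r⁻¹`; the one outside the unit circle is taken, so that the
  -- complex length has positive real part.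
  obtain ⟨E, hE, hE'⟩ : ∃ E : ℂ, 1 < ‖E‖ ∧ A.1.trace = E + E⁻¹ := by
    rcases lt_or_gt_of_ne hnorm with h1 | h1
    · refine ⟨r⁻¹, ?_, by rw [hr', inv_inv, add_comm]⟩
      rw [norm_inv]
      exact (one_lt_inv₀ (norm_pos_iff.2 hr0)).2 h1
    · exact ⟨r, h1, hr'⟩
  have hE0 : E ≠ 0 := by rintro rfl; norm_num at hE
  set l := Complex.log (E ^ 2) with hl
  have hl0 : 0 < l.re := by
    rw [hl, Complex.log_re, norm_pow]
    exact Real.log_pos (one_lt_pow₀ hE two_ne_zero)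
  have hsq : Complex.exp (l / 2) ^ 2 = E ^ 2 := by
    rw [exp_half_sq, hl, Complex.exp_log (pow_ne_zero 2 hE0)]
  have hlen : HasComplexLength (ρ.1 genA) l := by
    -- The principal logarithm of `E²` lies in the strip, at the price of `exp (l / 2) = ±E`; the
    -- sign is absorbed by replacing `A` with `-A`.
    rcases sq_eq_sq_iff_eq_or_eq_neg.1 hsq with h1 | h1
    · rw [← hA]
      exact hasComplexLength_of_trace hl0.le (by rw [h1]; exact hE')
    · rw [← hA, ← toPSL_neg]
      refine hasComplexLength_of_trace hl0.le ?_
      rw [h1, Matrix.SpecialLinearGroup.coe_neg, Matrix.trace_neg, hE', inv_neg]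
      ring
  obtain ⟨p, -, hp⟩ := exists_fnMap_eq b₀ hl0 (Complex.neg_pi_lt_log_im _)
    (Complex.log_im_le_pi _) ⟨ρ, rfl, hlen⟩
  exact ⟨p, hp⟩

/-! ### Discrete subgroups -/

/-- Makes the quotient `PSL(2, ℂ)` Hausdorff, so that discrete subgroups are closed. -/
instance : IsClosed (Subgroup.center SL2C : Set SL2C) := by
  refine Set.Finite.isClosed (Set.Finite.subset (Set.toFinite {1, -1}) fun A hA => ?_)
  exact (mem_center_SL2C_iff A).1 hA

lemma continuous_toPSL : Continuous toPSL := QuotientGroup.continuous_mk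

lemma isCompact_entries_le (K : ℝ) : IsCompact {A : SL2C | ∀ i j, ‖A.1 i j‖ ≤ K} := by
  have h1 : IsCompact {M : Matrix (Fin 2) (Fin 2) ℂ | ∀ i j, ‖M i j‖ ≤ K} := by
    have : {M : Matrix (Fin 2) (Fin 2) ℂ | ∀ i j, ‖M i j‖ ≤ K} =
        Set.univ.pi fun _ : Fin 2 => Set.univ.pi fun _ : Fin 2 => Metric.closedBall (0 : ℂ) K := by
      ext M
      exact ⟨fun h i _ j _ => mem_closedBall_zero_iff.2 (h i j),
        fun h i j => mem_closedBall_zero_iff.1 (h i trivial j trivial)⟩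
    rw [this]
    exact isCompact_univ_pi fun _ => isCompact_univ_pi fun _ => isCompact_closedBall _ _
  have h2 : IsClosed {M : Matrix (Fin 2) (Fin 2) ℂ | M.det = 1} :=
    isClosed_eq (Continuous.matrix_det continuous_id) continuous_const
  exact h2.isClosedEmbedding_subtypeVal.isCompact_preimage h1

/-- A bounded sequence in a conjugate of a discrete subgroup takes some value twice. -/
lemma exists_toPSL_eq_of_bounded {Γ : Subgroup PSL2C} (hΓ : DiscreteTopology Γ) (g : SL2C)
    (X : ℕ → SL2C) (hX : ∀ n, toPSL (g * X n * g⁻¹) ∈ Γ) {K : ℝ} (hK : ∀ n i j, ‖(X n).1 i j‖ ≤ K) :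
    ∃ n m, n ≠ m ∧ toPSL (g * X n * g⁻¹) = toPSL (g * X m * g⁻¹) := by
  have hcont : Continuous fun A : SL2C => toPSL (g * A * g⁻¹) :=
    continuous_toPSL.comp ((continuous_const.mul continuous_id).mul continuous_const)
  have hcl : IsClosed (Γ : Set PSL2C) := Subgroup.isClosed_of_discrete
  have hcomp : IsCompact ((fun A : SL2C => toPSL (g * A * g⁻¹)) '' {A : SL2C | ∀ i j, ‖A.1 i j‖ ≤ K} ∩ (Γ : Set PSL2C)) :=
    ((isCompact_entries_le K).image hcont).inter_right hcl
  have hdisc : DiscreteTopology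
      ↥((fun A : SL2C => toPSL (g * A * g⁻¹)) '' {A : SL2C | ∀ i j, ‖A.1 i j‖ ≤ K} ∩ (Γ : Set PSL2C)) :=
    DiscreteTopology.of_subset (s := (Γ : Set PSL2C)) hΓ Set.inter_subset_right
  have hfin := hcomp.finite ⟨hdisc⟩
  have := hfin.to_subtype
  obtain ⟨n, m, hnm, h⟩ := Finite.exists_ne_map_eq_of_infinite
    (fun n : ℕ => (⟨toPSL (g * X n * g⁻¹), ⟨X n, hK n, rfl⟩, hX n⟩ :
      ↥((fun A : SL2C => toPSL (g * A * g⁻¹)) '' {A : SL2C | ∀ i j, ‖A.1 i j‖ ≤ K} ∩ (Γ : Set PSL2C))))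
  exact ⟨n, m, hnm, congrArg Subtype.val h⟩

/-! ### Elliptic elements -/

/-- Cayley–Hamilton makes `Aⁿ` a combination of `A` and `1` with coefficients in powers of `r` and
`r⁻¹`; for `|r| = 1`, `r ≠ r⁻¹` this bounds all powers. -/
lemma pow_mul_eq (A : SL2C) {r : ℂ} (hr0 : r ≠ 0) (hr : A.1.trace = r + r⁻¹) (n : ℕ) :
    (r - r⁻¹) • (A ^ n : SL2C).1 =
      (r ^ n - r⁻¹ ^ n) • A.1 - (r ^ n * r⁻¹ - r⁻¹ ^ n * r) • (1 : Matrix (Fin 2) (Fin 2) ℂ) := by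
  have hch : A.1 * A.1 = (r + r⁻¹) • A.1 - (1 : Matrix (Fin 2) (Fin 2) ℂ) := by
    have dA := det_SL2C A
    rw [← hr]
    ext i j
    fin_cases i <;> fin_cases j <;>
      simp [Matrix.mul_apply, Fin.sum_univ_two, Matrix.trace_fin_two]
    · linear_combination -dA
    · ring
    · ring
    · linear_combination -dA
  have hi : r * r⁻¹ = 1 := mul_inv_cancel₀ hr0
  induction n with
  | zero => simp [sub_smul]
  | succ n ih =>
    rw [pow_succ, Matrix.SpecialLinearGroup.coe_mul, ← Matrix.smul_mul, ih, Matrix.sub_mul,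
      Matrix.smul_mul, Matrix.smul_mul, hch, Matrix.one_mul, smul_sub, smul_smul]
    rw [sub_right_comm, ← sub_smul]
    congr 2
    · rw [pow_succ, pow_succ]; ring
    · rw [pow_succ, pow_succ]; linear_combination (r⁻¹ ^ n - r ^ n) * hi

lemma pow_injective_of_ne_one {w : Pi1} (hw : w ≠ 1) {n m : ℕ} (h : w ^ n = w ^ m) : n = m := by
  have h1 : w ^ ((n : ℤ) - m) = 1 := by
    rw [_root_.zpow_sub, zpow_natCast, zpow_natCast, h, mul_inv_cancel]
  have := (IsMulTorsionFree.zpow_eq_one_iff_right hw).1 h1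
  omega

lemma genA_ne_one : genA ≠ 1 := FreeGroup.of_ne_one 0

/-- In a faithful representation with discrete image, the generator `a` is not elliptic. -/
lemma trace_eq_two_or_neg_two {ρ : Pi1 →* PSL2C} (hinj : Function.Injective ρ)
    (hd : DiscreteTopology ρ.range) {A : SL2C} (hA : toPSL A = ρ genA) {θ : ℝ}
    (h : A.1.trace = 2 * Real.cos θ) : A.1.trace = 2 ∨ A.1.trace = -2 := by
  obtain ⟨r, hrn, hr⟩ : ∃ r : ℂ, ‖r‖ = 1 ∧ A.1.trace = r + r⁻¹ := by
    refine ⟨Complex.exp (θ * Complex.I), Complex.norm_exp_ofReal_mul_I θ, ?_⟩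
    rw [h, Complex.ofReal_cos, Complex.cos, ← Complex.exp_neg]
    ring_nf
  have hr0 : r ≠ 0 := by rintro rfl; norm_num at hrn
  by_cases hrr : r - r⁻¹ = 0
  · have h1 : r ^ 2 = 1 := by field_simp at hrr; linear_combination hrr
    rcases sq_eq_one_iff.1 h1 with rfl | rfl
    · left; rw [hr]; norm_num
    · right; rw [hr]; norm_num
  exfalso
  have hbound : ∀ n i j, ‖(A ^ n : SL2C).1 i j‖ ≤ (2 * ‖A.1 i j‖ + 2) / ‖r - r⁻¹‖ := by
    intro n i j
    rw [le_div_iff₀ (norm_pos_iff.2 hrr), mul_comm, ← norm_mul]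
    have h1 := congrFun (congrFun (pow_mul_eq A hr0 hr n) i) j
    simp only [Matrix.smul_apply, Matrix.sub_apply, smul_eq_mul] at h1
    rw [h1]
    have h2 : ‖r ^ n - r⁻¹ ^ n‖ ≤ 2 := by
      refine (norm_sub_le _ _).trans ?_
      simp [hrn]; norm_num
    have h3 : ‖r ^ n * r⁻¹ - r⁻¹ ^ n * r‖ ≤ 2 := by
      refine (norm_sub_le _ _).trans ?_
      simp [hrn]; norm_num
    have h4 : ‖(1 : Matrix (Fin 2) (Fin 2) ℂ) i j‖ ≤ 1 := by
      rw [Matrix.one_apply]; split_ifs <;> simp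
    refine (norm_sub_le _ _).trans ?_
    rw [norm_mul, norm_mul]
    have := norm_nonneg (A.1 i j)
    have := norm_nonneg ((1 : Matrix (Fin 2) (Fin 2) ℂ) i j)
    nlinarith [norm_nonneg (r ^ n * r⁻¹ - r⁻¹ ^ n * r)]
  obtain ⟨K, hK⟩ : ∃ K : ℝ, ∀ i j, (2 * ‖A.1 i j‖ + 2) / ‖r - r⁻¹‖ ≤ K := by
    refine ⟨∑ i, ∑ j, (2 * ‖A.1 i j‖ + 2) / ‖r - r⁻¹‖, fun i j => ?_⟩
    refine le_trans ?_ (Finset.single_le_sum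
      (f := fun i => ∑ j, (2 * ‖A.1 i j‖ + 2) / ‖r - r⁻¹‖) (fun i _ => by positivity)
      (Finset.mem_univ i))
    exact Finset.single_le_sum (f := fun j => (2 * ‖A.1 i j‖ + 2) / ‖r - r⁻¹‖)
      (fun j _ => by positivity) (Finset.mem_univ j)
  obtain ⟨n, m, hnm, heq⟩ := exists_toPSL_eq_of_bounded hd 1 (fun n => A ^ n)
    (fun n => ⟨genA ^ n, by simp [hA]⟩)
    (fun n i j => (hbound n i j).trans (hK i j))
  rw [one_mul, one_mul, inv_one, mul_one, mul_one, map_pow, map_pow, hA, ← map_pow, ← map_pow] at heq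
  exact hnm (pow_injective_of_ne_one genA_ne_one (hinj heq))

/-! ### Parabolic elements of the modular group -/

/-- The group `SL(2, ℤ)`. -/
abbrev SL2Z : Type := Matrix.SpecialLinearGroup (Fin 2) ℤ

/-- The inclusion of `SL(2, ℤ)` in `SL(2, ℂ)`. -/
def intToSL2C : SL2Z →* SL2C := Matrix.SpecialLinearGroup.map (Int.castRingHom ℂ)

/-- The matrix `[1, 2; 0, 1]`. -/
def upperTwo : SL2Z := ⟨!![1, 2; 0, 1], by simp⟩

/-- The matrix `[1, 0; 2, 1]`. -/
def lowerTwo : SL2Z := ⟨!![1, 0; 2, 1], by simp⟩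

lemma coe_upperTwo : (upperTwo : Matrix (Fin 2) (Fin 2) ℤ) = !![1, 2; 0, 1] := rfl

lemma coe_lowerTwo : (lowerTwo : Matrix (Fin 2) (Fin 2) ℤ) = !![1, 0; 2, 1] := rfl

/-- The graph of the abelianization of the level two congruence subgroup, modulo `±1`. -/
def gammaTwoGraph : Subgroup (SL2Z × Multiplicative (ℤ × ℤ)) :=
  Subgroup.closure {(upperTwo, Multiplicative.ofAdd (1, 0)),
    (lowerTwo, Multiplicative.ofAdd (0, 1)), (-1, 1)}

/-- The linear map of `ℤ²` given by the images of the standard basis vectors. -/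
def latticeHom (u v : ℤ × ℤ) : Multiplicative (ℤ × ℤ) →* Multiplicative (ℤ × ℤ) where
  toFun p := Multiplicative.ofAdd ((Multiplicative.toAdd p).1 • u + (Multiplicative.toAdd p).2 • v)
  map_one' := by simp
  map_mul' p q := by
    rw [← ofAdd_add]; congr 1
    simp only [toAdd_mul, Prod.fst_add, Prod.snd_add, add_smul]
    abel

lemma prodMap_mk_apply {G H G' H' : Type*} [Group G] [Group H] [Group G'] [Group H']
    (f : G →* G') (g : H →* H') (x : G) (y : H) : f.prodMap g (x, y) = (f x, g y) := rfl

lemma latticeHom_apply (u v p : ℤ × ℤ) : latticeHom u v (Multiplicative.ofAdd p) =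
    Multiplicative.ofAdd (p.1 • u + p.2 • v) := rfl

lemma mul_mem_gammaTwoGraph {m n : SL2Z} {p q : ℤ × ℤ}
    (hm : (m, Multiplicative.ofAdd p) ∈ gammaTwoGraph)
    (hn : (n, Multiplicative.ofAdd q) ∈ gammaTwoGraph) :
    (m * n, Multiplicative.ofAdd (p + q)) ∈ gammaTwoGraph := by
  rw [ofAdd_add, ← Prod.mk_mul_mk]
  exact mul_mem hm hn

lemma inv_mem_gammaTwoGraph {m : SL2Z} {p : ℤ × ℤ}
    (hm : (m, Multiplicative.ofAdd p) ∈ gammaTwoGraph) :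
    (m⁻¹, Multiplicative.ofAdd (-p)) ∈ gammaTwoGraph := by
  rw [ofAdd_neg, ← Prod.inv_mk]
  exact inv_mem hm

/-- Conjugation by `γ` paired with the linear map sending the basis to `u`, `v` is a homomorphism,
so it suffices to know where the generators go. -/
lemma conj_mem_gammaTwoGraph {γ : SL2Z} {u v : ℤ × ℤ}
    (hu : (γ * upperTwo * γ⁻¹, Multiplicative.ofAdd u) ∈ gammaTwoGraph)
    (hv : (γ * lowerTwo * γ⁻¹, Multiplicative.ofAdd v) ∈ gammaTwoGraph)
    {m : SL2Z} {p : ℤ × ℤ} (h : (m, Multiplicative.ofAdd p) ∈ gammaTwoGraph) :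
    (γ * m * γ⁻¹, Multiplicative.ofAdd (p.1 • u + p.2 • v)) ∈ gammaTwoGraph := by
  have key : gammaTwoGraph ≤
      gammaTwoGraph.comap ((MulAut.conj γ).toMonoidHom.prodMap (latticeHom u v)) := by
    conv_lhs => rw [gammaTwoGraph]
    rw [Subgroup.closure_le]
    intro x hx
    simp only [Set.mem_insert_iff, Set.mem_singleton_iff] at hx
    rw [SetLike.mem_coe, Subgroup.mem_comap]
    rcases hx with hx | hx | hx
    · rw [hx, prodMap_mk_apply, latticeHom_apply]
      simpa using hu
    · rw [hx, prodMap_mk_apply, latticeHom_apply]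
      simpa using hv
    · have h1 : ((-1 : SL2Z), (1 : Multiplicative (ℤ × ℤ))) ∈ gammaTwoGraph :=
        Subgroup.subset_closure (by simp)
      rw [hx, prodMap_mk_apply, map_one]
      simpa using h1
  have h2 := Subgroup.mem_comap.1 (key h)
  rwa [prodMap_mk_apply, latticeHom_apply] at h2

/-- The set of homology classes of peripheral elements. -/
def peripheralClasses : Set (ℤ × ℤ) :=
  {(1, 0), (-1, 0), (0, 1), (0, -1), (1, -1), (-1, 1)}

lemma conj_S_upperTwo_lowerTwo {γ : SL2Z} (hγ : γ = ModularGroup.S ∨ γ = ModularGroup.S⁻¹) :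
    γ * upperTwo * γ⁻¹ = lowerTwo⁻¹ ∧ γ * lowerTwo * γ⁻¹ = upperTwo⁻¹ := by
  rcases hγ with rfl | rfl <;> constructor <;> ext1 <;>
    simp [coe_upperTwo, coe_lowerTwo, ModularGroup.coe_S, Matrix.adjugate_fin_two]

/-- The factor `-1` is the reason for putting `(-1, 1)` among the generators of `gammaTwoGraph`. -/
lemma conj_T_upperTwo_lowerTwo :
    ModularGroup.T * upperTwo * ModularGroup.T⁻¹ = upperTwo ∧
      ModularGroup.T * lowerTwo * ModularGroup.T⁻¹ = upperTwo * lowerTwo⁻¹ * -1 := by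
  constructor <;> ext i j <;> fin_cases i <;> fin_cases j <;>
    simp [coe_upperTwo, coe_lowerTwo, ModularGroup.coe_T, Matrix.adjugate_fin_two]

lemma conj_T_inv_upperTwo_lowerTwo :
    ModularGroup.T⁻¹ * upperTwo * ModularGroup.T⁻¹⁻¹ = upperTwo ∧
      ModularGroup.T⁻¹ * lowerTwo * ModularGroup.T⁻¹⁻¹ = lowerTwo⁻¹ * upperTwo * -1 := by
  constructor <;> ext i j <;> fin_cases i <;> fin_cases j <;>
    simp [coe_upperTwo, coe_lowerTwo, ModularGroup.coe_T, Matrix.adjugate_fin_two]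

/-- Induction on a word in the generators `S`, `T` of the modular group: conjugation by `S^{±1}`
acts on classes by `(p, q) ↦ (-q, -p)` and by `T^{±1}` as `(p, q) ↦ (p + q, -q)`, and both preserve
the six peripheral classes. -/
lemma exists_conj_upperTwo_mem (s : SL2Z) : ∃ p ∈ peripheralClasses,
    (s * upperTwo * s⁻¹, Multiplicative.ofAdd p) ∈ gammaTwoGraph := by
  have hA : (upperTwo, Multiplicative.ofAdd ((1, 0) : ℤ × ℤ)) ∈ gammaTwoGraph :=
    Subgroup.subset_closure (by simp)
  have hP : (lowerTwo, Multiplicative.ofAdd ((0, 1) : ℤ × ℤ)) ∈ gammaTwoGraph :=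
    Subgroup.subset_closure (by simp)
  have hneg : ((-1 : SL2Z), Multiplicative.ofAdd ((0, 0) : ℤ × ℤ)) ∈ gammaTwoGraph :=
    Subgroup.subset_closure (by right; right; rfl)
  have stepS : ∀ γ : SL2Z, γ = ModularGroup.S ∨ γ = ModularGroup.S⁻¹ →
      ∀ (m : SL2Z), (∃ p ∈ peripheralClasses, (m, Multiplicative.ofAdd p) ∈ gammaTwoGraph) →
      ∃ p ∈ peripheralClasses, (γ * m * γ⁻¹, Multiplicative.ofAdd p) ∈ gammaTwoGraph := by
    rintro γ hγ m ⟨p, hp, hm⟩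
    obtain ⟨h1, h2⟩ := conj_S_upperTwo_lowerTwo hγ
    refine ⟨_, ?_, conj_mem_gammaTwoGraph (u := -(0, 1)) (v := -(1, 0)) ?_ ?_ hm⟩
    · rcases hp with rfl | rfl | rfl | rfl | rfl | rfl <;> simp [peripheralClasses]
    · rw [h1]; exact inv_mem_gammaTwoGraph hP
    · rw [h2]; exact inv_mem_gammaTwoGraph hA
  have stepT : ∀ γ : SL2Z, γ = ModularGroup.T ∨ γ = ModularGroup.T⁻¹ →
      ∀ (m : SL2Z), (∃ p ∈ peripheralClasses, (m, Multiplicative.ofAdd p) ∈ gammaTwoGraph) →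
      ∃ p ∈ peripheralClasses, (γ * m * γ⁻¹, Multiplicative.ofAdd p) ∈ gammaTwoGraph := by
    rintro γ hγ m ⟨p, hp, hm⟩
    refine ⟨_, ?_, conj_mem_gammaTwoGraph (u := (1, 0)) (v := (1, 0) + -(0, 1) + (0, 0)) ?_ ?_ hm⟩
    · rcases hp with rfl | rfl | rfl | rfl | rfl | rfl <;> simp [peripheralClasses]
    · rcases hγ with rfl | rfl
      · rw [conj_T_upperTwo_lowerTwo.1]; exact hA
      · rw [conj_T_inv_upperTwo_lowerTwo.1]; exact hA
    · rcases hγ with rfl | rfl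
      · rw [conj_T_upperTwo_lowerTwo.2]
        exact mul_mem_gammaTwoGraph (mul_mem_gammaTwoGraph hA (inv_mem_gammaTwoGraph hP)) hneg
      · rw [conj_T_inv_upperTwo_lowerTwo.2]
        rw [add_comm ((1, 0) : ℤ × ℤ)]
        exact mul_mem_gammaTwoGraph (mul_mem_gammaTwoGraph (inv_mem_gammaTwoGraph hP) hA) hneg
  have hs : s ∈ Subgroup.closure {ModularGroup.S, ModularGroup.T} := by
    rw [SpecialLinearGroup.SL2Z_generators]; trivial
  have hassoc : ∀ x y : SL2Z, x * y * upperTwo * (x * y)⁻¹ = x * (y * upperTwo * y⁻¹) * x⁻¹ := by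
    intro x y; group
  induction hs using Subgroup.closure_induction_left with
  | one => exact ⟨(1, 0), by simp [peripheralClasses], by simpa using hA⟩
  | mul_left x hx y hy ih =>
    rw [hassoc]
    rcases hx with rfl | rfl
    · exact stepS _ (Or.inl rfl) _ ih
    · exact stepT _ (Or.inl rfl) _ ih
  | inv_mul_cancel x hx y hy ih =>
    rw [hassoc]
    rcases hx with rfl | rfl
    · exact stepS _ (Or.inr rfl) _ ih
    · exact stepT _ (Or.inr rfl) _ ih

/-! ### The normal form of a representation with parabolic `ρ(a)` -/

/-- The second matrix of the normal form. -/
def slantMatrix (k μ : ℂ) (hk : k ^ 2 = -1) : SL2C :=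
  mkSL 0 k k (k * μ) (by linear_combination -hk)

/-- The action of the free group on `ℚ` with `a` acting by `q ↦ 1 + q` and `b` by `q ↦ 2 * q`. -/
def affineHom : Pi1 →* Equiv.Perm ℚ :=
  FreeGroup.lift ![Equiv.addLeft 1, Equiv.mulLeft₀ 2 two_ne_zero]

lemma affineHom_genA : affineHom genA = Equiv.addLeft 1 := by simp [affineHom, genA]

lemma affineHom_genB : affineHom genB = Equiv.mulLeft₀ 2 two_ne_zero := by simp [affineHom, genB]

lemma intToSL2C_apply (m : SL2Z) (i j : Fin 2) : (intToSL2C m).1 i j = (m.1 i j : ℂ) := rfl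

lemma intToSL2C_upperTwo : (intToSL2C upperTwo).1 = !![1, 2; 0, 1] := by
  ext i j
  rw [intToSL2C_apply]
  fin_cases i <;> fin_cases j <;> simp [coe_upperTwo]

lemma intToSL2C_lowerTwo (k μ : ℂ) (hk : k ^ 2 = -1) :
    slantMatrix k μ hk * intToSL2C upperTwo * (slantMatrix k μ hk)⁻¹ = intToSL2C lowerTwo := by
  have h2 : (intToSL2C lowerTwo).1 = !![1, 0; 2, 1] := by
    ext i j
    rw [intToSL2C_apply]
    fin_cases i <;> fin_cases j <;> simp [coe_lowerTwo]
  apply Subtype.ext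
  rw [Matrix.SpecialLinearGroup.coe_mul, Matrix.SpecialLinearGroup.coe_mul, intToSL2C_upperTwo, h2,
    slantMatrix, mkSL_inv, mkSL_val, mkSL_val]
  ext i j
  fin_cases i <;> fin_cases j <;> simp [Matrix.mul_apply, Fin.sum_univ_two]
  · linear_combination -hk
  · linear_combination -2 * hk
  · linear_combination -hk

/-- Elements of the graph are realized by elements of the free group. -/
lemma exists_word_of_mem_gammaTwoGraph {k μ : ℂ} (hk : k ^ 2 = -1) {m : SL2Z} {p : ℤ × ℤ}
    (h : (m, Multiplicative.ofAdd p) ∈ gammaTwoGraph) :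
    ∃ u : Pi1, toPSL (liftRep (intToSL2C upperTwo) (slantMatrix k μ hk) u) = toPSL (intToSL2C m) ∧
      affineHom u = Equiv.addLeft ((p.1 : ℚ) + 2 * p.2) := by
  -- In the affine action `a` translates by `1` and `bab⁻¹` by `2`, so class `(p, q)` corresponds to
  -- translation by `p + 2q`.
  let τ : Multiplicative (ℤ × ℤ) →* Equiv.Perm ℚ :=
    { toFun := fun p => Equiv.addLeft
        (((Multiplicative.toAdd p).1 : ℚ) + 2 * (Multiplicative.toAdd p).2)
      map_one' := by ext q; simp
      map_mul' := by
        intro p q; ext x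
        simp only [toAdd_mul, Prod.fst_add, Prod.snd_add, Int.cast_add, Equiv.coe_addLeft,
          Equiv.Perm.coe_mul, Function.comp_apply]
        ring }
  let f : Pi1 →* PSL2C × Equiv.Perm ℚ :=
    (toPSL.comp (liftRep (intToSL2C upperTwo) (slantMatrix k μ hk))).prod affineHom
  let F : SL2Z × Multiplicative (ℤ × ℤ) →* PSL2C × Equiv.Perm ℚ :=
    (toPSL.comp intToSL2C).prodMap τ
  have key : gammaTwoGraph ≤ f.range.comap F := by
    rw [gammaTwoGraph, Subgroup.closure_le]
    rintro _ (rfl | rfl | rfl)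
    · refine ⟨genA, Prod.ext (by simp [f, F]) ?_⟩
      ext q
      simp [f, F, τ, affineHom_genA]
    · refine ⟨genB * genA * genB⁻¹, Prod.ext ?_ ?_⟩
      · change toPSL _ = toPSL (intToSL2C lowerTwo)
        rw [← intToSL2C_lowerTwo k μ hk]
        simp
      · ext q
        simp [f, F, τ, affineHom_genA, affineHom_genB]
        ring
    · refine ⟨1, Prod.ext ?_ ?_⟩
      · change toPSL _ = toPSL (intToSL2C (-1))
        have : intToSL2C (-1) = -1 := by
          ext i j; fin_cases i <;> fin_cases j <;> simp [intToSL2C]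
        rw [this, toPSL_neg, map_one]
      · simp [f, F]
  obtain ⟨u, hu⟩ := key h
  exact ⟨u, congrArg Prod.fst hu, congrArg Prod.snd hu⟩

/-- On the six peripheral classes `p + 2q` takes only the values `±1`, `±2`; in particular these
translations are nonzero and bounded, uniformly in `s`. -/
lemma exists_word_conj_upperTwo {k μ : ℂ} (hk : k ^ 2 = -1) (s : SL2Z) :
    ∃ (u : Pi1) (r : ℚ), (r = 1 ∨ r = -1 ∨ r = 2 ∨ r = -2) ∧
      toPSL (liftRep (intToSL2C upperTwo) (slantMatrix k μ hk) u) =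
        toPSL (intToSL2C (s * upperTwo * s⁻¹)) ∧ affineHom u = Equiv.addLeft r := by
  obtain ⟨p, hp, h⟩ := exists_conj_upperTwo_mem s
  obtain ⟨u, hu1, hu2⟩ := exists_word_of_mem_gammaTwoGraph (μ := μ) hk h
  refine ⟨u, _, ?_, hu1, hu2⟩
  rcases hp with rfl | rfl | rfl | rfl | rfl | rfl <;> norm_num

/-! ### Reduction theory -/

lemma im_smul_I_mul (G : Matrix.SpecialLinearGroup (Fin 2) ℝ) :
    (G • UpperHalfPlane.I).im * (G.1 1 0 ^ 2 + G.1 1 1 ^ 2) = 1 := by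
  have hd : G.1 0 0 * G.1 1 1 - G.1 0 1 * G.1 1 0 = 1 := by
    rw [← Matrix.det_fin_two]; exact G.2
  have hpos : G.1 1 0 ^ 2 + G.1 1 1 ^ 2 ≠ 0 := by
    intro h
    have h1 : G.1 1 0 = 0 := by nlinarith [sq_nonneg (G.1 1 0), sq_nonneg (G.1 1 1)]
    have h2 : G.1 1 1 = 0 := by nlinarith [sq_nonneg (G.1 1 0), sq_nonneg (G.1 1 1)]
    rw [h1, h2] at hd; norm_num at hd
  rw [← UpperHalfPlane.coe_im, UpperHalfPlane.coe_specialLinearGroup_apply]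
  simp [Complex.div_im, Complex.normSq_apply]
  have e : G.1 1 0 * G.1 1 0 + G.1 1 1 * G.1 1 1 ≠ 0 := by
    intro h; apply hpos; linear_combination h
  have e2 : G.1 1 1 * G.1 1 1 + G.1 1 0 * G.1 1 0 ≠ 0 := by
    intro h; apply hpos; linear_combination h
  have e3 : G.1 1 1 ^ 2 + G.1 1 0 ^ 2 ≠ 0 := by
    intro h; apply hpos; linear_combination h
  field_simp
  linear_combination (G.1 1 0 ^ 2 + G.1 1 1 ^ 2) * hd

/-- Every real unimodular matrix can be multiplied by an integral one so that the bottom row is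
bounded. -/
lemma exists_SL2Z_mul_bottom_row_le (M : Matrix.SpecialLinearGroup (Fin 2) ℝ) :
    ∃ s : SL2Z, ∀ G, G = Matrix.SpecialLinearGroup.map (Int.castRingHom ℝ) s * M →
      G.1 1 0 ^ 2 + G.1 1 1 ^ 2 ≤ 2 := by
  obtain ⟨s, hs⟩ := ModularGroup.exists_smul_mem_fd (M • UpperHalfPlane.I)
  refine ⟨s, ?_⟩
  rintro G rfl
  set G := Matrix.SpecialLinearGroup.map (Int.castRingHom ℝ) s * M with hG
  have h1 : s • M • UpperHalfPlane.I = G • UpperHalfPlane.I := by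
    rw [hG, mul_smul]
    apply UpperHalfPlane.ext
    rw [UpperHalfPlane.coe_specialLinearGroup_apply s,
      UpperHalfPlane.coe_specialLinearGroup_apply (Matrix.SpecialLinearGroup.map _ s)]
    simp
  rw [h1] at hs
  -- In the fundamental domain the height `1 / (c² + d²)` of `G • i` is at least `√3 / 2`, so `c² +
  -- d² ≤ 2 / √3 < 2`.
  have h2 := ModularGroup.three_le_four_mul_im_sq_of_mem_fd hs
  have h3 := im_smul_I_mul G
  have h4 := UpperHalfPlane.im_pos (G • UpperHalfPlane.I)
  nlinarith

/-! ### The slant is not real -/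

lemma affineHom_genB_pow (j : ℕ) (x : ℚ) : affineHom (genB ^ j) x = 2 ^ j * x := by
  induction j generalizing x with
  | zero => simp
  | succ j ih =>
    rw [pow_succ, map_mul, Equiv.Perm.mul_apply, ih, affineHom_genB]
    change 2 ^ j * (2 * x) = 2 ^ (j + 1) * x
    ring

/-- Since `b²ⁿ` scales by `4ⁿ`, the conjugate is translation by `r / 4ⁿ`, read off here at the point
`0`. -/
lemma affineHom_conj_eq {u : Pi1} {r : ℚ} (h : affineHom u = Equiv.addLeft r) (n : ℕ) :
    affineHom ((genB ^ (2 * n))⁻¹ * u * genB ^ (2 * n)) 0 * 4 ^ n = r := by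
  have h1 : affineHom (genB ^ (2 * n)) (affineHom ((genB ^ (2 * n))⁻¹ * u * genB ^ (2 * n)) 0)
      = r := by
    rw [← Equiv.Perm.mul_apply, ← map_mul, ← mul_assoc, ← mul_assoc, mul_inv_cancel, one_mul,
      map_mul, Equiv.Perm.mul_apply, affineHom_genB_pow, h]
    simp
  rw [affineHom_genB_pow, pow_mul] at h1
  linear_combination h1

/-- The quotient of two of these values has absolute value `1/2`, `1` or `2`, never a nontrivial
power of `4`. -/
lemma eq_of_mul_four_pow {y r r' : ℚ} {n m : ℕ} (hr : r = 1 ∨ r = -1 ∨ r = 2 ∨ r = -2)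
    (hr' : r' = 1 ∨ r' = -1 ∨ r' = 2 ∨ r' = -2) (h : y * 4 ^ n = r) (h' : y * 4 ^ m = r') :
    n = m := by
  have key : ∀ {n m : ℕ} {r r' : ℚ}, (r = 1 ∨ r = -1 ∨ r = 2 ∨ r = -2) →
      (r' = 1 ∨ r' = -1 ∨ r' = 2 ∨ r' = -2) → y * 4 ^ n = r → y * 4 ^ m = r' → ¬ n < m := by
    intro n m r r' hr hr' h h' hlt
    obtain ⟨d, rfl⟩ := Nat.exists_eq_add_of_lt hlt
    have h1 : r' = r * 4 ^ d * 4 := by rw [← h', ← h]; ring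
    have h2 : (1 : ℚ) ≤ 4 ^ d := one_le_pow₀ (by norm_num)
    rcases hr with rfl | rfl | rfl | rfl <;> rcases hr' with rfl | rfl | rfl | rfl <;> linarith
  exact le_antisymm (not_lt.1 (key hr' hr h' h)) (not_lt.1 (key hr hr' h h'))

/-- The inclusion of `SL(2, ℝ)` in `SL(2, ℂ)`. -/
def realToSL2C : Matrix.SpecialLinearGroup (Fin 2) ℝ →* SL2C :=
  Matrix.SpecialLinearGroup.map Complex.ofRealHom

lemma realToSL2C_apply (G : Matrix.SpecialLinearGroup (Fin 2) ℝ) (i j : Fin 2) :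
    (realToSL2C G).1 i j = (G.1 i j : ℂ) := rfl

lemma realToSL2C_map (s : SL2Z) :
    realToSL2C (Matrix.SpecialLinearGroup.map (Int.castRingHom ℝ) s) = intToSL2C s := by
  apply Subtype.ext
  ext i j
  rw [realToSL2C_apply, intToSL2C_apply]
  simp

/-- The matrix is `k` times a real one of determinant `-1`, which exchanges the half-planes; only
its even powers come from `SL(2, ℝ)`. -/
lemma exists_slantMatrix_sq_eq {k μ : ℂ} (hk : k ^ 2 = -1) (hμ : μ.im = 0) :
    ∃ M, slantMatrix k μ hk ^ 2 = -realToSL2C M := by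
  obtain ⟨m, rfl⟩ : ∃ m : ℝ, (m : ℂ) = μ := ⟨μ.re, Complex.ext rfl hμ.symm⟩
  obtain ⟨M, hM⟩ : ∃ M : Matrix.SpecialLinearGroup (Fin 2) ℝ, M.1 = !![1, m; m, 1 + m ^ 2] :=
    ⟨⟨!![1, m; m, 1 + m ^ 2], by rw [Matrix.det_fin_two_of]; ring⟩, rfl⟩
  refine ⟨M, ?_⟩
  apply Subtype.ext
  rw [sq, Matrix.SpecialLinearGroup.coe_mul, Matrix.SpecialLinearGroup.coe_neg, slantMatrix,
    mkSL_val]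
  ext i j
  rw [Matrix.neg_apply, realToSL2C_apply, hM]
  fin_cases i <;> fin_cases j <;> simp [Matrix.mul_apply, Fin.sum_univ_two]
  · linear_combination hk
  · linear_combination (m : ℂ) * hk
  · linear_combination (m : ℂ) * hk
  · linear_combination (1 + (m : ℂ) ^ 2) * hk

/-- The conjugate has entries `1 ± 2cd`, `2d²`, `-2c²`, which involve only the bottom row `(c, d)`
of `G`. -/
lemma norm_conj_upperTwo_le {G : Matrix.SpecialLinearGroup (Fin 2) ℝ}
    (h : G.1 1 0 ^ 2 + G.1 1 1 ^ 2 ≤ 2) (i j : Fin 2) :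
    ‖((realToSL2C G)⁻¹ * intToSL2C upperTwo * realToSL2C G : SL2C).1 i j‖ ≤ 5 := by
  have hd : G.1 0 0 * G.1 1 1 - G.1 0 1 * G.1 1 0 = 1 := by
    rw [← Matrix.det_fin_two]; exact G.2
  have key : ((realToSL2C G)⁻¹ * intToSL2C upperTwo * realToSL2C G : SL2C).1 i j =
      (((!![1 + 2 * (G.1 1 0 * G.1 1 1), 2 * G.1 1 1 ^ 2;
        -2 * G.1 1 0 ^ 2, 1 - 2 * (G.1 1 0 * G.1 1 1)] : Matrix (Fin 2) (Fin 2) ℝ) i j : ℝ) : ℂ) := by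
    have hd' : (G.1 0 0 : ℂ) * G.1 1 1 - G.1 0 1 * G.1 1 0 = 1 := by exact_mod_cast hd
    rw [Matrix.SpecialLinearGroup.coe_mul, Matrix.SpecialLinearGroup.coe_mul,
      Matrix.SpecialLinearGroup.coe_inv, intToSL2C_upperTwo, Matrix.adjugate_fin_two]
    simp only [realToSL2C_apply]
    fin_cases i <;> fin_cases j <;> simp [Matrix.mul_apply, Fin.sum_univ_two, realToSL2C_apply]
    · linear_combination hd'
    · ring
    · ring
    · linear_combination hd'
  rw [key, Complex.norm_real, Real.norm_eq_abs, abs_le]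
  fin_cases i <;> fin_cases j <;> simp <;> constructor <;>
    nlinarith [sq_nonneg (G.1 1 0 + G.1 1 1), sq_nonneg (G.1 1 0 - G.1 1 1),
      sq_nonneg (G.1 1 0), sq_nonneg (G.1 1 1)]

lemma toPSL_conj (g X : SL2C) : toPSL (g * X * g⁻¹) = toPSL g * toPSL X * (toPSL g)⁻¹ := by
  rw [map_mul, map_mul, map_inv]

/-- A faithful representation with discrete image in normal form does not preserve the real
circle. -/
lemma slant_im_ne_zero {ρ : Pi1 →* PSL2C} (hinj : Function.Injective ρ)
    (hd : DiscreteTopology ρ.range) {k μ : ℂ} {hk : k ^ 2 = -1} {g : SL2C}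
    (hρ : ∀ w, ρ w = toPSL (g * liftRep (intToSL2C upperTwo) (slantMatrix k μ hk) w * g⁻¹)) :
    μ.im ≠ 0 := by
  intro hμ
  obtain ⟨M, hM⟩ := exists_slantMatrix_sq_eq hk hμ
  -- For each `n`, `sₙ Mⁿ` has bounded bottom row, and `uₙ` is a word representing `sₙ⁻¹ [1, 2; 0,
  -- 1] sₙ`. Conjugating the latter by `M⁻ⁿ` gives a bounded matrix representing `b⁻²ⁿ uₙ b²ⁿ`.
  choose s hs using fun n : ℕ => exists_SL2Z_mul_bottom_row_le (M ^ n)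
  choose u r hr hu hr' using fun n : ℕ => exists_word_conj_upperTwo (μ := μ) hk (s n)⁻¹
  have hb : ∀ n : ℕ, toPSL (slantMatrix k μ hk ^ (2 * n)) = toPSL (realToSL2C (M ^ n)) := by
    intro n
    rw [pow_mul, hM, map_pow, toPSL_neg, map_pow, map_pow]
  have hX : ∀ n, toPSL (g * ((realToSL2C (Matrix.SpecialLinearGroup.map (Int.castRingHom ℝ) (s n)
        * M ^ n))⁻¹ * intToSL2C upperTwo *
      realToSL2C (Matrix.SpecialLinearGroup.map (Int.castRingHom ℝ) (s n) * M ^ n)) * g⁻¹) =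
      ρ ((genB ^ (2 * n))⁻¹ * u n * genB ^ (2 * n)) := by
    intro n
    rw [hρ, toPSL_conj, toPSL_conj]
    congr 2
    rw [map_mul (liftRep _ _), map_mul (liftRep _ _), map_mul toPSL, map_mul toPSL, map_mul toPSL,
      map_mul toPSL, hu, map_inv (liftRep _ _), map_pow (liftRep _ _), liftRep_genB, map_inv toPSL,
      map_inv toPSL, hb, map_mul realToSL2C, realToSL2C_map]
    simp only [map_mul, map_inv, _root_.mul_inv_rev, inv_inv, mul_assoc]
  obtain ⟨n, m, hnm, h⟩ := exists_toPSL_eq_of_bounded hd g _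
    (fun n => ⟨_, (hX n).symm⟩) (fun n => norm_conj_upperTwo_le (hs n _ rfl))
  rw [hX, hX] at h
  have hw := hinj h
  have h1 := affineHom_conj_eq (hr' n) n
  have h2 := affineHom_conj_eq (hr' m) m
  rw [← hw] at h2
  exact hnm (eq_of_mul_four_pow (hr n) (hr m) h1 h2)

/-! ### Trace normalization and the Riemann sphere -/

/-- A matrix scaled to have trace one. -/
def normTr (M : Matrix (Fin 2) (Fin 2) ℂ) : Matrix (Fin 2) (Fin 2) ℂ := M.trace⁻¹ • M

lemma normTr_smul {c : ℂ} (hc : c ≠ 0) (M : Matrix (Fin 2) (Fin 2) ℂ) :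
    normTr (c • M) = normTr M := by
  rw [normTr, normTr, Matrix.trace_smul, smul_smul, smul_eq_mul]
  congr 1
  rw [mul_inv, mul_right_comm, inv_mul_cancel₀ hc, one_mul]

lemma hypAct_eq (A : SL2C) (M : Matrix (Fin 2) (Fin 2) ℂ) :
    hypAct A M = normTr (A.1 * M * A.1ᴴ) := rfl

lemma det_normTr (M : Matrix (Fin 2) (Fin 2) ℂ) :
    (normTr M).det = M.trace⁻¹ ^ 2 * M.det := by
  rw [normTr, Matrix.det_smul, Fintype.card_fin]

lemma tendsto_normTr {ι : Type*} {l : Filter ι} {f : ι → Matrix (Fin 2) (Fin 2) ℂ}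
    {M : Matrix (Fin 2) (Fin 2) ℂ} (hf : Tendsto f l (𝓝 M)) (hM : M.trace ≠ 0) :
    Tendsto (fun i => normTr (f i)) l (𝓝 (normTr M)) := by
  have h1 : Tendsto (fun i => (f i).trace) l (𝓝 M.trace) :=
    ((Continuous.matrix_trace continuous_id).tendsto M).comp hf
  exact (h1.inv₀ hM).smul hf

/-- The point of the Riemann sphere with homogeneous coordinates `v`. -/
def ray (v : Fin 2 → ℂ) : Matrix (Fin 2) (Fin 2) ℂ := normTr (vecMulVec v (star v))

lemma trace_vecMulVec_star_ne_zero {v : Fin 2 → ℂ} (hv : v ≠ 0) :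
    (vecMulVec v (star v)).trace ≠ 0 := by
  rw [Matrix.trace_vecMulVec]
  exact fun h => hv (dotProduct_self_star_eq_zero.1 h)

lemma ray_smul {c : ℂ} (hc : c ≠ 0) (v : Fin 2 → ℂ) : ray (c • v) = ray v := by
  have : vecMulVec (c • v) (star (c • v)) = (c * star c) • vecMulVec v (star v) := by
    ext i j
    simp [vecMulVec_apply]
    ring
  rw [ray, this, normTr_smul (mul_ne_zero hc (star_ne_zero.2 hc)), ray]

lemma ray_mem_idealBoundary {v : Fin 2 → ℂ} (hv : v ≠ 0) : ray v ∈ IdealBoundary := by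
  have hps := Matrix.posSemidef_vecMulVec_self_star v
  have ht := trace_vecMulVec_star_ne_zero hv
  refine ⟨?_, ?_, ?_⟩
  · exact hps.smul (inv_nonneg.2 hps.trace_nonneg)
  · rw [ray, normTr, Matrix.trace_smul, smul_eq_mul, inv_mul_cancel₀ ht]
  · rw [ray, det_normTr, Matrix.det_fin_two]
    simp [vecMulVec_apply]
    right
    ring

lemma exists_ray_eq {M : Matrix (Fin 2) (Fin 2) ℂ} (hM : M ∈ IdealBoundary) :
    ∃ v : Fin 2 → ℂ, v ≠ 0 ∧ M = ray v := by
  obtain ⟨hps, htr, hdet⟩ := hM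
  have hnorm : M = normTr M := by rw [normTr, htr, inv_one, one_smul]
  have h10 : star (M 0 1) = M 1 0 := hps.1.apply 1 0
  have h11 : star (M 1 1) = M 1 1 := hps.1.apply 1 1
  rw [Matrix.det_fin_two] at hdet
  rw [Matrix.trace_fin_two] at htr
  by_cases h : M 1 1 = 0
  · have h01 : M 0 1 = 0 := by
      rw [h, mul_zero, zero_sub, neg_eq_zero, ← h10] at hdet
      rcases mul_eq_zero.1 hdet with h2 | h2
      · exact h2
      · exact star_eq_zero.1 h2
    have h10' : M 1 0 = 0 := by rw [← h10, h01, star_zero]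
    have h00 : M 0 0 = 1 := by rw [← htr, h, add_zero]
    refine ⟨![1, 0], fun h0 => by simpa using congrFun h0 0, ?_⟩
    have : vecMulVec ![1, 0] (star ![1, 0]) = M := by
      ext i j
      fin_cases i <;> fin_cases j <;> simp [vecMulVec_apply, h, h01, h10', h00]
    rw [ray, this, ← hnorm]
  · refine ⟨![M 0 1, M 1 1], fun h0 => h (by simpa using congrFun h0 1), ?_⟩
    have : vecMulVec ![M 0 1, M 1 1] (star ![M 0 1, M 1 1]) = M 1 1 • M := by
      ext i j
      fin_cases i <;> fin_cases j <;> simp only [vecMulVec_apply, Pi.star_apply, Matrix.smul_apply]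
      · simp [-RCLike.star_def, h10]; linear_combination -hdet
      · simp [-RCLike.star_def, h11]; ring
      · simp [-RCLike.star_def, h10]
      · simp [-RCLike.star_def, h11]
    rw [ray, this, normTr_smul h, ← hnorm]

lemma mul_vecMulVec_mul_conjTranspose (A : Matrix (Fin 2) (Fin 2) ℂ) (v : Fin 2 → ℂ) :
    A * vecMulVec v (star v) * Aᴴ = vecMulVec (A *ᵥ v) (star (A *ᵥ v)) := by
  rw [Matrix.mul_vecMulVec, Matrix.vecMulVec_mul, Matrix.star_mulVec]

lemma normTr_mul_normTr (D M : Matrix (Fin 2) (Fin 2) ℂ) (hM : M.trace ≠ 0) :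
    normTr (D * normTr M * Dᴴ) = normTr (D * M * Dᴴ) := by
  conv_lhs => rw [normTr.eq_def M, Matrix.mul_smul, Matrix.smul_mul]
  exact normTr_smul (inv_ne_zero hM) _

lemma normTr_mul_ray (D : Matrix (Fin 2) (Fin 2) ℂ) {v : Fin 2 → ℂ} (hv : v ≠ 0) :
    normTr (D * ray v * Dᴴ) = ray (D *ᵥ v) := by
  rw [ray, normTr_mul_normTr _ _ (trace_vecMulVec_star_ne_zero hv),
    mul_vecMulVec_mul_conjTranspose, ray]

lemma hypAct_ray (A : SL2C) {v : Fin 2 → ℂ} (hv : v ≠ 0) : hypAct A (ray v) = ray (A.1 *ᵥ v) :=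
  normTr_mul_ray A.1 hv

lemma mulVec_ne_zero_SL2C (A : SL2C) {v : Fin 2 → ℂ} (hv : v ≠ 0) : A.1 *ᵥ v ≠ 0 := by
  intro h
  apply hv
  have h1 : (A⁻¹ : SL2C).1 *ᵥ (A.1 *ᵥ v) = v := by
    rw [Matrix.mulVec_mulVec, ← Matrix.SpecialLinearGroup.coe_mul]; simp
  rw [← h1, h, Matrix.mulVec_zero]

/-- A matrix of rank one contracts everything to its image. -/
lemma normTr_rank_one (v w : Fin 2 → ℂ) (M : Matrix (Fin 2) (Fin 2) ℂ)
    (h : (vecMulVec v w * M * (vecMulVec v w)ᴴ).trace ≠ 0) :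
    normTr (vecMulVec v w * M * (vecMulVec v w)ᴴ) = ray v := by
  have key : vecMulVec v w * M * (vecMulVec v w)ᴴ =
      ((w ᵥ* M) ⬝ᵥ star w) • vecMulVec v (star v) := by
    rw [Matrix.vecMulVec_mul, Matrix.conjTranspose_vecMulVec, Matrix.vecMulVec_mul_vecMulVec]
    ext i j
    simp [vecMulVec_apply]
    ring
  rw [key] at h ⊢
  have hc : (w ᵥ* M) ⬝ᵥ star w ≠ 0 := by
    intro hc; rw [hc, zero_smul, Matrix.trace_zero] at h; exact h rfl
  rw [normTr_smul hc, ray]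

lemma exists_vecMulVec_of_det_eq_zero {D : Matrix (Fin 2) (Fin 2) ℂ} (h : D.det = 0) :
    ∃ v w : Fin 2 → ℂ, D = vecMulVec v w := by
  rw [Matrix.det_fin_two] at h
  by_cases h0 : D 0 0 = 0
  · by_cases h1 : D 1 0 = 0
    · refine ⟨fun i => D i 1, ![0, 1], ?_⟩
      ext i j
      fin_cases i <;> fin_cases j <;> simp [vecMulVec_apply, h0, h1]
    · refine ⟨fun i => D i 0, ![1, D 1 1 / D 1 0], ?_⟩
      ext i j
      fin_cases i <;> fin_cases j <;> simp [vecMulVec_apply, h0]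
      · rw [h0, zero_mul, zero_sub, neg_eq_zero] at h
        exact (mul_eq_zero.1 h).resolve_right h1
      · field_simp
  · refine ⟨fun i => D i 0, ![1, D 0 1 / D 0 0], ?_⟩
    ext i j
    fin_cases i <;> fin_cases j <;> simp [vecMulVec_apply]
    · field_simp
    · field_simp; linear_combination h

/-- A positive semidefinite matrix of trace zero vanishes, while the diagonal entry at a nonzero row
of `D` is a value of the positive definite form `p`. Stated for all `D ≠ 0` because it is applied to
singular limits of group elements. -/
lemma trace_mul_posDef_mul_ne_zero {p : Matrix (Fin 2) (Fin 2) ℂ} (hp : p.PosDef)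
    {D : Matrix (Fin 2) (Fin 2) ℂ} (hD : D ≠ 0) : (D * p * Dᴴ).trace ≠ 0 := by
  intro h
  rw [(hp.posSemidef.mul_mul_conjTranspose_same D).trace_eq_zero_iff] at h
  apply hD
  ext i j
  by_contra hij
  have hx : star (D i) ≠ 0 := by
    intro hx
    exact hij (congrFun (star_eq_zero.1 hx) j)
  have h1 := hp.dotProduct_mulVec_pos hx
  have h2 : star (star (D i)) ⬝ᵥ p *ᵥ star (D i) = (D * p * Dᴴ) i i := by
    rw [star_star, Matrix.dotProduct_mulVec]
    rfl
  rw [h2, h, Matrix.zero_apply] at h1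
  exact lt_irrefl _ h1

lemma SL2C_ne_zero (A : SL2C) : A.1 ≠ 0 := by
  intro h
  have := A.2
  rw [h, Matrix.det_zero] at this
  exact zero_ne_one this

lemma hypAct_hypAct (A B : SL2C) {p : Matrix (Fin 2) (Fin 2) ℂ} (hp : p.PosDef) :
    hypAct A (hypAct B p) = hypAct (A * B) p := by
  rw [hypAct_eq, hypAct_eq, normTr_mul_normTr _ _ (trace_mul_posDef_mul_ne_zero hp (SL2C_ne_zero B)),
    hypAct_eq, Matrix.SpecialLinearGroup.coe_mul, Matrix.conjTranspose_mul]
  simp only [Matrix.mul_assoc]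

lemma det_hypAct_ne_zero (A : SL2C) {p : Matrix (Fin 2) (Fin 2) ℂ} (hp : p.PosDef) :
    (hypAct A p).det ≠ 0 := by
  rw [hypAct_eq, det_normTr, Matrix.det_mul, Matrix.det_mul, Matrix.det_conjTranspose, A.2]
  have h1 := trace_mul_posDef_mul_ne_zero hp (SL2C_ne_zero A)
  have h2 := hp.det_pos.ne'
  simp [h1, h2]

/-! ### The limit set -/

/-- Orbit points have nonzero determinant and ideal points do not, so an ideal point in the closure
is automatically an accumulation point. -/
lemma mem_limitSet_iff {Γ : Subgroup PSL2C} {ξ : IdealBoundary} :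
    ξ ∈ limitSet Γ ↔ ∃ p ∈ HypSpace, ξ.1 ∈ closure (hypOrbit Γ p) := by
  refine exists_congr fun p => and_congr_right fun hp => ?_
  constructor
  · intro h
    exact mem_closure_iff_clusterPt.2 h.clusterPt
  · intro h
    rw [accPt_principal_iff_nhdsWithin, Set.sdiff_singleton_eq_self, ← mem_closure_iff_nhdsWithin_neBot]
    · exact h
    · rintro ⟨A, -, hA⟩
      exact det_hypAct_ne_zero A hp.1 (hA ▸ ξ.2.2.2)

/-- The action of `SL(2, ℂ)` preserves the Riemann sphere. -/
lemma hypAct_mem_idealBoundary (A : SL2C) (ξ : IdealBoundary) : hypAct A ξ.1 ∈ IdealBoundary := by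
  obtain ⟨v, hv, h⟩ := exists_ray_eq ξ.2
  rw [h, hypAct_ray A hv]
  exact ray_mem_idealBoundary (mulVec_ne_zero_SL2C A hv)

lemma continuousAt_hypAct (A : SL2C) (ξ : IdealBoundary) : ContinuousAt (hypAct A) ξ.1 := by
  refine tendsto_normTr (f := fun M => A.1 * M * A.1ᴴ) ?_ ?_
  · exact ((continuous_const.matrix_mul continuous_id).matrix_mul continuous_const).tendsto ξ.1
  · obtain ⟨v, hv, h⟩ := exists_ray_eq ξ.2
    rw [h, ray, normTr, Matrix.mul_smul, Matrix.smul_mul, mul_vecMulVec_mul_conjTranspose,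
      Matrix.trace_smul]
    exact mul_ne_zero (inv_ne_zero (trace_vecMulVec_star_ne_zero hv))
      (trace_vecMulVec_star_ne_zero (mulVec_ne_zero_SL2C A hv))

lemma hypAct_mem_limitSet {Γ : Subgroup PSL2C} {A : SL2C} (hA : toPSL A ∈ Γ) {ξ η : IdealBoundary}
    (hξ : ξ ∈ limitSet Γ) (hη : η.1 = hypAct A ξ.1) : η ∈ limitSet Γ := by
  rw [mem_limitSet_iff] at hξ ⊢
  obtain ⟨p, hp, h⟩ := hξ
  refine ⟨p, hp, ?_⟩
  rw [hη]
  refine closure_mono ?_ ((continuousAt_hypAct A ξ).continuousWithinAt.mem_closure_image h)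
  rintro _ ⟨_, ⟨B, hB, rfl⟩, rfl⟩
  exact ⟨A * B, by rw [map_mul]; exact Γ.mul_mem hA hB, hypAct_hypAct A B hp.1⟩

lemma hypAct_inv_hypAct (A : SL2C) (ξ : IdealBoundary) : hypAct A⁻¹ (hypAct A ξ.1) = ξ.1 := by
  obtain ⟨v, hv, h⟩ := exists_ray_eq ξ.2
  rw [h, hypAct_ray A hv, hypAct_ray _ (mulVec_ne_zero_SL2C A hv), Matrix.mulVec_mulVec,
    ← Matrix.SpecialLinearGroup.coe_mul]
  simp

/-- The sum of the absolute values of the entries. -/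
def entrySum (D : Matrix (Fin 2) (Fin 2) ℂ) : ℝ := ∑ i, ∑ j, ‖D i j‖

lemma entrySum_pos {D : Matrix (Fin 2) (Fin 2) ℂ} (hD : D ≠ 0) : 0 < entrySum D := by
  have h0 : 0 ≤ entrySum D := Finset.sum_nonneg fun i _ => Finset.sum_nonneg fun j _ => norm_nonneg _
  refine lt_of_le_of_ne h0 fun h => hD ?_
  ext i j
  have h1 := (Finset.sum_eq_zero_iff_of_nonneg
    (fun i _ => Finset.sum_nonneg fun j _ => norm_nonneg (D i j))).1 h.symm i (Finset.mem_univ i)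
  have h2 := (Finset.sum_eq_zero_iff_of_nonneg
    (fun j _ => norm_nonneg (D i j))).1 h1 j (Finset.mem_univ j)
  simpa using h2

lemma entrySum_smul {c : ℝ} (hc : 0 ≤ c) (D : Matrix (Fin 2) (Fin 2) ℂ) :
    entrySum ((c : ℂ) • D) = c * entrySum D := by
  simp only [entrySum, Matrix.smul_apply, smul_eq_mul, norm_mul, Complex.norm_real,
    Finset.mul_sum, Real.norm_of_nonneg hc]

lemma isCompact_entrySum_eq_one : IsCompact {D | entrySum D = 1} := by
  have h1 : IsCompact (Set.univ.pi fun _ : Fin 2 => Set.univ.pi fun _ : Fin 2 =>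
      Metric.closedBall (0 : ℂ) 1) :=
    isCompact_univ_pi fun _ => isCompact_univ_pi fun _ => isCompact_closedBall _ _
  have hcont : Continuous entrySum := by
    refine continuous_finsetSum _ fun i _ => continuous_finsetSum _ fun j _ => ?_
    exact (continuous_id.matrix_elem i j).norm
  refine h1.of_isClosed_subset (isClosed_eq hcont continuous_const) ?_
  intro D hD i _ j _
  rw [mem_closedBall_zero_iff, ← (show entrySum D = 1 from hD)]
  refine le_trans ?_ (Finset.single_le_sum (f := fun i => ∑ j, ‖D i j‖)
    (fun i _ => Finset.sum_nonneg fun j _ => norm_nonneg _) (Finset.mem_univ i))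
  exact Finset.single_le_sum (f := fun j => ‖D i j‖) (fun j _ => norm_nonneg _) (Finset.mem_univ j)

lemma hypAct_eq_normTr_smul (A : SL2C) {c : ℝ} (hc : c ≠ 0) (M : Matrix (Fin 2) (Fin 2) ℂ) :
    hypAct A M = normTr (((c : ℂ) • A.1) * M * ((c : ℂ) • A.1)ᴴ) := by
  have hc' : (c : ℂ) ≠ 0 := by exact_mod_cast hc
  rw [Matrix.conjTranspose_smul, Matrix.smul_mul, Matrix.smul_mul, Matrix.mul_smul,
    normTr_smul hc', normTr_smul (star_ne_zero.2 hc'), hypAct_eq]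

/-- The domain of discontinuity is dense as soon as it has two points. -/
lemma dense_discontinuityDomain {Γ : Subgroup PSL2C} {q₁ q₂ : IdealBoundary} (hne : q₁ ≠ q₂)
    (h₁ : q₁ ∈ discontinuityDomain Γ) (h₂ : q₂ ∈ discontinuityDomain Γ) :
    Dense (discontinuityDomain Γ) := by
  intro ξ
  by_cases hξ : ξ ∈ discontinuityDomain Γ
  · exact subset_closure hξ
  obtain ⟨p, hp, h⟩ := mem_limitSet_iff.1 (not_not.1 hξ)
  have horb : hypOrbit Γ p = (fun A : SL2C => hypAct A p) '' {A | toPSL A ∈ Γ} := by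
    ext M
    constructor
    · rintro ⟨A, hA, rfl⟩; exact ⟨A, hA, rfl⟩
    · rintro ⟨A, hA, rfl⟩; exact ⟨A, hA, rfl⟩
  rw [horb, mem_closure_iff_clusterPt, ← Filter.map_principal] at h
  obtain ⟨U, hU, htend⟩ := mapClusterPt_iff_ultrafilter.1 h
  have hUΓ : ∀ᶠ A in (U : Filter SL2C), toPSL A ∈ Γ := hU (mem_principal_self _)
  -- Rescaling does not change the action after trace normalization, and the rescaled matrices
  -- converge along `U` to some `D ≠ 0` by compactness.
  let N : SL2C → Matrix (Fin 2) (Fin 2) ℂ := fun A => (((entrySum A.1)⁻¹ : ℝ) : ℂ) • A.1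
  have hNc : ∀ A : SL2C, (entrySum A.1)⁻¹ ≠ 0 := fun A =>
    inv_ne_zero (entrySum_pos (SL2C_ne_zero A)).ne'
  have hN1 : ∀ A, entrySum (N A) = 1 := by
    intro A
    have hpos := entrySum_pos (SL2C_ne_zero A)
    have : entrySum (N A) = (entrySum A.1)⁻¹ * entrySum A.1 :=
      entrySum_smul (inv_nonneg.2 hpos.le) A.1
    rw [this, inv_mul_cancel₀ hpos.ne']
  obtain ⟨D, hD1, hD⟩ := isCompact_entrySum_eq_one.ultrafilter_le_nhds' (U.map N)
    (Filter.Eventually.of_forall hN1 : ∀ᶠ A in (U : Filter SL2C), entrySum (N A) = 1)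
  have hND : Tendsto N U (𝓝 D) := hD
  have hD0 : D ≠ 0 := by
    rintro rfl
    have h0 : entrySum (0 : Matrix (Fin 2) (Fin 2) ℂ) = 1 := hD1
    simp [entrySum] at h0
  have hlim : ∀ M : Matrix (Fin 2) (Fin 2) ℂ, (D * M * Dᴴ).trace ≠ 0 →
      Tendsto (fun A : SL2C => hypAct A M) U (𝓝 (normTr (D * M * Dᴴ))) := by
    intro M hM
    have h1 : Tendsto (fun A => N A * M * (N A)ᴴ) U (𝓝 (D * M * Dᴴ)) := by
      have hc : Continuous fun E : Matrix (Fin 2) (Fin 2) ℂ => E * M * Eᴴ :=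
        (continuous_id.matrix_mul continuous_const).matrix_mul continuous_id.matrix_conjTranspose
      exact (hc.tendsto D).comp hND
    refine (tendsto_normTr h1 hM).congr fun A => ?_
    exact (hypAct_eq_normTr_smul A (hNc A) M).symm
  have htr := trace_mul_posDef_mul_ne_zero hp.1 hD0
  have hξp : ξ.1 = normTr (D * p * Dᴴ) := tendsto_nhds_unique htend (hlim p htr)
  -- Otherwise the limit of the orbit would be an interior point rather than `ξ`. Hence `D` has rank
  -- one and sends every line outside its kernel to `ξ`.
  have hdet : D.det = 0 := by
    have h1 := ξ.2.2.2
    rw [hξp, det_normTr, Matrix.det_mul, Matrix.det_mul, Matrix.det_conjTranspose] at h1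
    have h2 := hp.1.det_pos.ne'
    simpa [htr, h2] using h1
  obtain ⟨v, w, hvw⟩ := exists_vecMulVec_of_det_eq_zero hdet
  have hray : ξ.1 = ray v := by
    rw [hξp, hvw]
    exact normTr_rank_one v w p (by rw [← hvw]; exact htr)
  -- The kernel of `D` is a single line, so it contains at most one of the two given points; the
  -- translates of the other tend to `ξ` and stay in the domain.
  obtain ⟨q, hq, x, hx0, hx, hDx⟩ : ∃ q ∈ discontinuityDomain Γ, ∃ x : Fin 2 → ℂ, x ≠ 0 ∧
      q.1 = ray x ∧ D *ᵥ x ≠ 0 := by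
    obtain ⟨x₁, hx₁, hr₁⟩ := exists_ray_eq q₁.2
    obtain ⟨x₂, hx₂, hr₂⟩ := exists_ray_eq q₂.2
    by_cases hd1 : D *ᵥ x₁ = 0
    · by_cases hd2 : D *ᵥ x₂ = 0
      · exfalso
        obtain ⟨c, hc⟩ := parallel_of_mulVec_eq_zero hD0 hx₁ hd1 hd2
        have hc0 : c ≠ 0 := by rintro rfl; exact hx₂ (by rw [hc, zero_smul])
        apply hne
        rw [Subtype.ext_iff, hr₁, hr₂, hc, ray_smul hc0]
      · exact ⟨q₂, h₂, x₂, hx₂, hr₂, hd2⟩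
    · exact ⟨q₁, h₁, x₁, hx₁, hr₁, hd1⟩
  have htrq : (D * q.1 * Dᴴ).trace ≠ 0 := by
    rw [hx, ray, normTr, Matrix.mul_smul, Matrix.smul_mul, mul_vecMulVec_mul_conjTranspose,
      Matrix.trace_smul]
    exact mul_ne_zero (inv_ne_zero (trace_vecMulVec_star_ne_zero hx0))
      (trace_vecMulVec_star_ne_zero hDx)
  have hqξ : Tendsto (fun A : SL2C => hypAct A q.1) U (𝓝 ξ.1) := by
    have h1 : normTr (D * q.1 * Dᴴ) = ray v := by
      rw [hvw]
      exact normTr_rank_one v w q.1 (by rw [← hvw]; exact htrq)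
    rw [hray, ← h1]
    exact hlim q.1 htrq
  rw [closure_subtype]
  refine mem_closure_of_tendsto hqξ ?_
  filter_upwards [hUΓ] with A hA
  refine ⟨⟨hypAct A q.1, hypAct_mem_idealBoundary A q⟩, ?_, rfl⟩
  intro hlimit
  refine hq (hypAct_mem_limitSet (A := A⁻¹) (by rw [map_inv]; exact Γ.inv_mem hA) hlimit ?_)
  exact (hypAct_inv_hypAct A q).symm

/-! ### Circles in the limit set -/

/-- The `n`-th power is `1 + nD` with `D` of rank one. Divided by `n` it tends to `D`, whose image
is the fixed line of the parabolic, so the orbit of `p` tends to that fixed point. -/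
lemma ray_mem_closure_of_parabolic {Γ : Subgroup PSL2C} {C : SL2C}
    (hC : ∀ n : ℕ, toPSL (C * intToSL2C upperTwo ^ n * C⁻¹) ∈ Γ)
    {p : Matrix (Fin 2) (Fin 2) ℂ} (hp : p ∈ HypSpace) :
    ray (C.1 *ᵥ ![1, 0]) ∈ closure (hypOrbit Γ p) := by
  have hpow : ∀ n : ℕ, (intToSL2C upperTwo ^ n : SL2C).1 =
      (1 : Matrix (Fin 2) (Fin 2) ℂ) + (n : ℂ) • !![0, 2; 0, 0] := by
    intro n
    induction n with
    | zero => simp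
    | succ n ih =>
      rw [pow_succ, Matrix.SpecialLinearGroup.coe_mul, ih, intToSL2C_upperTwo]
      ext i j
      fin_cases i <;> fin_cases j <;> simp [Matrix.mul_apply, Fin.sum_univ_two]
      ring
  have hD : (C.1 * !![0, 2; 0, 0] * (C⁻¹ : SL2C).1 : Matrix (Fin 2) (Fin 2) ℂ) =
      vecMulVec (C.1 *ᵥ ![1, 0]) (![0, 2] ᵥ* (C⁻¹ : SL2C).1) := by
    have : (!![0, 2; 0, 0] : Matrix (Fin 2) (Fin 2) ℂ) = vecMulVec ![1, 0] ![0, 2] := by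
      ext i j
      fin_cases i <;> fin_cases j <;> simp [vecMulVec_apply]
    rw [this, Matrix.mul_vecMulVec, Matrix.vecMulVec_mul]
  set D := (C.1 * !![0, 2; 0, 0] * (C⁻¹ : SL2C).1 : Matrix (Fin 2) (Fin 2) ℂ) with hDdef
  have hD0 : D ≠ 0 := by
    intro h
    have h1 : (C⁻¹ : SL2C).1 * D * C.1 = !![0, 2; 0, 0] := by
      have hCC : (C⁻¹ : SL2C).1 * C.1 = 1 := by
        rw [← Matrix.SpecialLinearGroup.coe_mul]; simp
      rw [hDdef, Matrix.mul_assoc, Matrix.mul_assoc, Matrix.mul_assoc, hCC, Matrix.mul_one,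
        ← Matrix.mul_assoc, hCC, Matrix.one_mul]
    rw [h, Matrix.mul_zero, Matrix.zero_mul] at h1
    have := congrFun (congrFun h1 0) 1
    simp at this
  have htr := trace_mul_posDef_mul_ne_zero hp.1 hD0
  have hray : normTr (D * p * Dᴴ) = ray (C.1 *ᵥ ![1, 0]) := by
    rw [hD]
    exact normTr_rank_one _ _ p (by rw [← hD]; exact htr)
  have hlim : Tendsto (fun n : ℕ => (((1 / ((n : ℝ) + 1) : ℝ)) : ℂ) •
      (C * intToSL2C upperTwo ^ (n + 1) * C⁻¹ : SL2C).1) atTop (𝓝 D) := by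
    have h1 : Tendsto (fun n : ℕ => ((1 / ((n : ℝ) + 1) : ℝ) : ℂ) •
        (1 : Matrix (Fin 2) (Fin 2) ℂ) + D) atTop (𝓝 D) := by
      have h2 : Tendsto (fun n : ℕ => ((1 / ((n : ℝ) + 1) : ℝ) : ℂ)) atTop (𝓝 ((0 : ℝ) : ℂ)) :=
        (Complex.continuous_ofReal.tendsto 0).comp tendsto_one_div_add_atTop_nhds_zero_nat
      have h3 := (h2.smul_const (1 : Matrix (Fin 2) (Fin 2) ℂ)).add_const D
      simpa using h3
    refine h1.congr fun n => ?_
    have hn : ((n : ℂ) + 1) ≠ 0 := by exact_mod_cast Nat.succ_ne_zero n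
    have hCC : C.1 * (C⁻¹ : SL2C).1 = 1 := by
      rw [← Matrix.SpecialLinearGroup.coe_mul]; simp
    rw [Matrix.SpecialLinearGroup.coe_mul, Matrix.SpecialLinearGroup.coe_mul, hpow,
      Matrix.mul_add, Matrix.add_mul, Matrix.mul_one, hCC, Matrix.mul_smul, Matrix.smul_mul,
      ← hDdef, smul_add, smul_smul]
    congr 1
    have : ((1 / ((n : ℝ) + 1) : ℝ) : ℂ) * ((n + 1 : ℕ) : ℂ) = 1 := by
      push_cast; field_simp
    rw [this, one_smul]
  have hcont : Continuous fun E : Matrix (Fin 2) (Fin 2) ℂ => E * p * Eᴴ :=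
    (continuous_id.matrix_mul continuous_const).matrix_mul continuous_id.matrix_conjTranspose
  have hlim2 := tendsto_normTr ((hcont.tendsto D).comp hlim) htr
  rw [hray] at hlim2
  refine mem_closure_of_tendsto hlim2 (Filter.Eventually.of_forall fun n => ?_)
  refine ⟨C * intToSL2C upperTwo ^ (n + 1) * C⁻¹, hC _, ?_⟩
  rw [hypAct_eq_normTr_smul _ (one_div_pos.2 (Nat.cast_add_one_pos n)).ne']
  rfl

lemma continuous_ray_comp {f : ℝ → Fin 2 → ℂ} (hf : Continuous f) (h0 : ∀ t, f t ≠ 0) :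
    Continuous fun t => ray (f t) := by
  refine continuous_iff_continuousAt.2 fun t => ?_
  have hc : Continuous fun t => vecMulVec (f t) (star (f t)) := hf.matrix_vecMulVec hf.star
  exact tendsto_normTr (hc.tendsto t) (trace_vecMulVec_star_ne_zero (h0 t))

lemma exists_SL2Z_mulVec (q : ℚ) : ∃ s : SL2Z,
    (intToSL2C s).1 *ᵥ ![1, 0] = (q.den : ℂ) • ![(q : ℂ), 1] := by
  have hcop : IsCoprime q.num (q.den : ℤ) := by
    rw [Int.isCoprime_iff_nat_coprime]; simpa using q.reduced
  obtain ⟨a, b, hab⟩ := hcop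
  obtain ⟨s, hs⟩ : ∃ s : SL2Z, s.1 = !![q.num, -b; q.den, a] :=
    ⟨⟨!![q.num, -b; q.den, a], by rw [Matrix.det_fin_two_of]; linear_combination hab⟩, rfl⟩
  refine ⟨s, ?_⟩
  have hden : (q.den : ℂ) ≠ 0 := by exact_mod_cast q.den_ne_zero
  have hq : (q.den : ℂ) * q = q.num := by
    rw [Rat.cast_def]; field_simp
  ext i
  simp only [Matrix.mulVec, dotProduct, Fin.sum_univ_two, intToSL2C_apply, hs]
  fin_cases i <;> simp [hq]

/-! ### The real circle and its preimage under `b` in the limit set -/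

section NormalForm

variable {ρ : Pi1 →* PSL2C} {k μ : ℂ} {hk : k ^ 2 = -1} {g : SL2C}

/-- Each point `s • ∞` is fixed by the parabolic `s [1, 2; 0, 1] s⁻¹`, which is realized in the
group. Rational points are of this form, and density then gives the whole circle. -/
lemma ray_int_mem_closure
    (hρ : ∀ w, ρ w = toPSL (g * liftRep (intToSL2C upperTwo) (slantMatrix k μ hk) w * g⁻¹))
    (s : SL2Z) {p : Matrix (Fin 2) (Fin 2) ℂ} (hp : p ∈ HypSpace) :
    ray (g.1 *ᵥ ((intToSL2C s).1 *ᵥ ![1, 0])) ∈ closure (hypOrbit ρ.range p) := by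
  obtain ⟨u, -, -, hu, -⟩ := exists_word_conj_upperTwo (μ := μ) hk s
  rw [Matrix.mulVec_mulVec, ← Matrix.SpecialLinearGroup.coe_mul]
  refine ray_mem_closure_of_parabolic (fun n => MonoidHom.mem_range.2 ⟨u ^ n, ?_⟩) hp
  have h1 : ρ u = toPSL (g * intToSL2C s * intToSL2C upperTwo * (g * intToSL2C s)⁻¹) := by
    rw [hρ, toPSL_conj, hu]
    simp only [map_mul, map_inv, _root_.mul_inv_rev, mul_assoc]
  rw [map_pow, h1, ← map_pow, conj_pow]

lemma ray_real_mem_closure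
    (hρ : ∀ w, ρ w = toPSL (g * liftRep (intToSL2C upperTwo) (slantMatrix k μ hk) w * g⁻¹))
    (t : ℝ) {p : Matrix (Fin 2) (Fin 2) ℂ} (hp : p ∈ HypSpace) :
    ray (g.1 *ᵥ ![(t : ℂ), 1]) ∈ closure (hypOrbit ρ.range p) := by
  have hne : ∀ t : ℝ, g.1 *ᵥ ![(t : ℂ), 1] ≠ 0 := fun t =>
    mulVec_ne_zero_SL2C g fun h => by simpa using congrFun h 1
  have hcont : Continuous fun t : ℝ => ray (g.1 *ᵥ ![(t : ℂ), 1]) := by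
    refine continuous_ray_comp (continuous_const.matrix_mulVec ?_) hne
    refine continuous_pi fun i => ?_
    fin_cases i
    · exact Complex.continuous_ofReal
    · exact continuous_const
  have hcl : IsClosed {t : ℝ | ray (g.1 *ᵥ ![(t : ℂ), 1]) ∈ closure (hypOrbit ρ.range p)} :=
    isClosed_closure.preimage hcont
  refine hcl.closure_subset_iff.2 ?_ (Rat.denseRange_cast t)
  rintro _ ⟨q, rfl⟩
  obtain ⟨s, hs⟩ := exists_SL2Z_mulVec q
  have h1 := ray_int_mem_closure hρ s hp
  rw [hs, Matrix.mulVec_smul, ray_smul (by exact_mod_cast q.den_ne_zero)] at h1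
  simpa using h1

/-- The defining function of the real circle, in the coordinate given by `g`. -/
def circleFun (g : SL2C) (ξ : IdealBoundary) : ℝ :=
  (((g⁻¹ : SL2C).1 * ξ.1 * (g⁻¹ : SL2C).1ᴴ) 0 1).im

/-- The defining function of the preimage of the real circle under `b`, in the coordinate given
by `g`. -/
def slantCircleFun (g : SL2C) (μ : ℂ) (ξ : IdealBoundary) : ℝ :=
  circleFun g ξ + μ.im * (((g⁻¹ : SL2C).1 * ξ.1 * (g⁻¹ : SL2C).1ᴴ) 1 1).re

lemma continuous_pullback (g : SL2C) : Continuous fun ξ : IdealBoundary =>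
    (g⁻¹ : SL2C).1 * ξ.1 * (g⁻¹ : SL2C).1ᴴ :=
  (continuous_const.matrix_mul continuous_subtype_val).matrix_mul continuous_const

lemma continuous_circleFun (g : SL2C) : Continuous (circleFun g) :=
  Complex.continuous_im.comp ((continuous_pullback g).matrix_elem 0 1)

lemma continuous_slantCircleFun (g : SL2C) (μ : ℂ) : Continuous (slantCircleFun g μ) :=
  (continuous_circleFun g).add (continuous_const.mul
    (Complex.continuous_re.comp ((continuous_pullback g).matrix_elem 1 1)))

lemma exists_ray_eq_mulVec (g : SL2C) (ξ : IdealBoundary) :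
    ∃ v : Fin 2 → ℂ, v ≠ 0 ∧ ξ.1 = ray (g.1 *ᵥ v) := by
  obtain ⟨v, hv, h⟩ := exists_ray_eq ξ.2
  refine ⟨(g⁻¹ : SL2C).1 *ᵥ v, mulVec_ne_zero_SL2C _ hv, ?_⟩
  rw [Matrix.mulVec_mulVec, ← Matrix.SpecialLinearGroup.coe_mul]
  simpa using h

/-- In the affine coordinate `z = v₀ / v₁`, the two functions are positive multiples of `|v₁|² Im z`
and `|v₁|² (Im z + Im μ)`. Only signs and zeros matter later, so the factor `c` may depend on the
point. -/
lemma circleFun_ray {g : SL2C} {ξ : IdealBoundary} {v : Fin 2 → ℂ} (hv : v ≠ 0)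
    (h : ξ.1 = ray (g.1 *ᵥ v)) : ∃ c : ℝ, 0 < c ∧
      circleFun g ξ = c * (v 0 * star (v 1)).im ∧
      ∀ μ, slantCircleFun g μ ξ = c * ((v 0 * star (v 1)).im + μ.im * (v 1 * star (v 1)).re) := by
  have hgv := mulVec_ne_zero_SL2C g hv
  have hpos : 0 < (vecMulVec (g.1 *ᵥ v) (star (g.1 *ᵥ v))).trace :=
    lt_of_le_of_ne (Matrix.posSemidef_vecMulVec_self_star _).trace_nonneg
      (trace_vecMulVec_star_ne_zero hgv).symm
  obtain ⟨t, ht, ht'⟩ : ∃ t : ℝ, 0 < t ∧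
      (vecMulVec (g.1 *ᵥ v) (star (g.1 *ᵥ v))).trace = (t : ℂ) := by
    rw [Complex.lt_def] at hpos
    exact ⟨_, hpos.1, Complex.ext rfl hpos.2.symm⟩
  have hpull : (g⁻¹ : SL2C).1 * ξ.1 * (g⁻¹ : SL2C).1ᴴ = ((t⁻¹ : ℝ) : ℂ) • vecMulVec v (star v) := by
    rw [h, ray, normTr, ht', Matrix.mul_smul, Matrix.smul_mul, mul_vecMulVec_mul_conjTranspose,
      Matrix.mulVec_mulVec, ← Matrix.SpecialLinearGroup.coe_mul, Complex.ofReal_inv]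
    simp
  have h1 : circleFun g ξ = t⁻¹ * (v 0 * star (v 1)).im := by
    rw [circleFun, hpull, Matrix.smul_apply, smul_eq_mul, Complex.im_ofReal_mul]
    rfl
  refine ⟨t⁻¹, inv_pos.2 ht, h1, fun μ => ?_⟩
  rw [slantCircleFun, h1, hpull, Matrix.smul_apply, smul_eq_mul, Complex.re_ofReal_mul]
  change _ + _ * (_ * (v 1 * star (v 1)).re) = _
  ring

lemma mem_limitSet_of_circleFun_eq_zero
    (hρ : ∀ w, ρ w = toPSL (g * liftRep (intToSL2C upperTwo) (slantMatrix k μ hk) w * g⁻¹))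
    {ξ : IdealBoundary} (h : circleFun g ξ = 0) : ξ ∈ limitSet ρ.range := by
  obtain ⟨p, hp⟩ : ∃ p, p ∈ HypSpace := by
    refine ⟨(2⁻¹ : ℂ) • 1, Matrix.PosDef.one.smul (by norm_num), ?_⟩
    rw [Matrix.trace_smul, Matrix.trace_one]
    norm_num
  rw [mem_limitSet_iff]
  refine ⟨p, hp, ?_⟩
  obtain ⟨v, hv, hξ⟩ := exists_ray_eq_mulVec g ξ
  obtain ⟨c, hc, h1, -⟩ := circleFun_ray hv hξ
  rw [h] at h1
  have him : (v 0 * star (v 1)).im = 0 := (mul_eq_zero.1 h1.symm).resolve_left hc.ne'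
  rw [hξ]
  by_cases hv1 : v 1 = 0
  · have hv0 : v 0 ≠ 0 := by
      intro hv0; apply hv; ext i; fin_cases i <;> simp [hv0, hv1]
    have hv' : v = v 0 • ((intToSL2C 1).1 *ᵥ ![1, 0]) := by
      rw [map_one]
      ext i
      fin_cases i <;> simp [hv1]
    rw [hv', Matrix.mulVec_smul, ray_smul hv0]
    exact ray_int_mem_closure hρ 1 hp
  · have him' : (v 0 / v 1).im = 0 := by
      simp only [RCLike.star_def, Complex.mul_im, Complex.conj_im, Complex.conj_re] at him
      rw [Complex.div_im, ← sub_div]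
      rw [show (v 0).im * (v 1).re - (v 0).re * (v 1).im = 0 by linear_combination him, zero_div]
    have hv' : v = v 1 • ![(((v 0 / v 1).re : ℝ) : ℂ), 1] := by
      have : (((v 0 / v 1).re : ℝ) : ℂ) = v 0 / v 1 := Complex.ext rfl him'.symm
      rw [this]
      ext i
      fin_cases i
      · simp; field_simp
      · simp
    rw [hv', Matrix.mulVec_smul, ray_smul hv1]
    exact ray_real_mem_closure hρ _ hp

/-- The element `b` acts by `z ↦ 1 / (z + μ)`, which carries `Im z = -Im μ` to the real circle;
invariance of the limit set pulls membership back. -/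
lemma mem_limitSet_of_slantCircleFun_eq_zero
    (hρ : ∀ w, ρ w = toPSL (g * liftRep (intToSL2C upperTwo) (slantMatrix k μ hk) w * g⁻¹))
    {ξ : IdealBoundary} (h : slantCircleFun g μ ξ = 0) : ξ ∈ limitSet ρ.range := by
  obtain ⟨v, hv, hξ⟩ := exists_ray_eq_mulVec g ξ
  obtain ⟨c, hc, -, h1⟩ := circleFun_ray hv hξ
  have h2 : (v 0 * star (v 1)).im + μ.im * (v 1 * star (v 1)).re = 0 := by
    have h3 := h1 μ
    rw [h] at h3
    exact (mul_eq_zero.1 h3.symm).resolve_left hc.ne'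
  set N := slantMatrix k μ hk with hN
  have hNmem : toPSL (g * N * g⁻¹) ∈ ρ.range := ⟨genB, by rw [hρ, liftRep_genB]⟩
  have hNv := mulVec_ne_zero_SL2C N hv
  let η : IdealBoundary := ⟨ray (g.1 *ᵥ (N.1 *ᵥ v)), ray_mem_idealBoundary (mulVec_ne_zero_SL2C g hNv)⟩
  have hη : η.1 = hypAct (g * N * g⁻¹) ξ.1 := by
    rw [hξ, hypAct_ray _ (mulVec_ne_zero_SL2C g hv), Matrix.mulVec_mulVec,
      ← Matrix.SpecialLinearGroup.coe_mul, inv_mul_cancel_right, Matrix.SpecialLinearGroup.coe_mul,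
      ← Matrix.mulVec_mulVec]
  have hηlim : η ∈ limitSet ρ.range := by
    apply mem_limitSet_of_circleFun_eq_zero hρ
    obtain ⟨d, -, h4, -⟩ := circleFun_ray (ξ := η) hNv rfl
    rw [h4]
    have h5 : (N.1 *ᵥ v) 0 * star ((N.1 *ᵥ v) 1) = (k * star k) * (v 1 * star (v 0 + μ * v 1)) := by
      simp [hN, slantMatrix, Matrix.mulVec, dotProduct, Fin.sum_univ_two]
      ring
    have h6 : (v 1 * star (v 0 + μ * v 1)).im = 0 := by
      simp only [RCLike.star_def, map_add, map_mul, Complex.mul_im, Complex.mul_re, Complex.add_im,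
        Complex.add_re, Complex.conj_im, Complex.conj_re] at h2 ⊢
      linear_combination -h2
    have h7 : (k * star k).im = 0 := by
      simp [Complex.mul_im]; ring
    rw [h5, Complex.mul_im, h6, h7]
    ring
  refine hypAct_mem_limitSet (A := (g * N * g⁻¹)⁻¹)
    (by rw [map_inv]; exact ρ.range.inv_mem hNmem) hηlim ?_
  rw [hη, hypAct_inv_hypAct]

end NormalForm

/-! ### Counting components -/

lemma pos_iff_of_isPreconnected {X : Type*} [TopologicalSpace X] {U : Set X}
    (hU : IsPreconnected U) {f : X → ℝ} (hf : Continuous f) (h0 : ∀ x ∈ U, f x ≠ 0) {x y : X}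
    (hx : x ∈ U) (hy : y ∈ U) (h : 0 < f x) : 0 < f y := by
  by_contra hy0
  obtain ⟨z, hz, hz0⟩ := hU.intermediate_value hy hx hf.continuousOn ⟨not_lt.1 hy0, h.le⟩
  exact h0 z hz hz0

/-- Two connected sets avoiding two hypersurfaces cannot have dense union, if the hypersurfaces
have three complementary regions. -/
lemma not_dense_union_of_three_regions {X : Type*} [TopologicalSpace X] {U V : Set X}
    (hU : IsPreconnected U) (hV : IsPreconnected V) (hdense : Dense (U ∪ V)) {f₁ f₂ : X → ℝ}
    (hf₁ : Continuous f₁) (hf₂ : Continuous f₂) (h₁ : ∀ x ∈ U ∪ V, f₁ x ≠ 0)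
    (h₂ : ∀ x ∈ U ∪ V, f₂ x ≠ 0) (hx : ∃ x, f₁ x < 0) (hy : ∃ y, 0 < f₁ y ∧ f₂ y < 0)
    (hz : ∃ z, 0 < f₁ z ∧ 0 < f₂ z) : False := by
  obtain ⟨x, hx', hxΩ⟩ := hdense.inter_open_nonempty {x | f₁ x < 0}
    (isOpen_lt hf₁ continuous_const) hx
  obtain ⟨y, ⟨hy', hy''⟩, hyΩ⟩ := hdense.inter_open_nonempty ({x | 0 < f₁ x} ∩ {x | f₂ x < 0})
    ((isOpen_lt continuous_const hf₁).inter (isOpen_lt hf₂ continuous_const)) hy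
  obtain ⟨z, ⟨hz', hz''⟩, hzΩ⟩ := hdense.inter_open_nonempty ({x | 0 < f₁ x} ∩ {x | 0 < f₂ x})
    ((isOpen_lt continuous_const hf₁).inter (isOpen_lt continuous_const hf₂)) hz
  have key : ∀ {W : Set X}, IsPreconnected W → W ⊆ U ∪ V → ∀ {f : X → ℝ}, Continuous f →
      (∀ x ∈ U ∪ V, f x ≠ 0) → ∀ {a b : X}, a ∈ W → b ∈ W → 0 < f a → ¬ f b < 0 :=
    fun hW hsub _ hf h0 _ _ ha hb hpos =>
      (pos_iff_of_isPreconnected hW hf (fun x hx => h0 x (hsub hx)) ha hb hpos).not_gt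
  have hUs : U ⊆ U ∪ V := Set.subset_union_left
  have hVs : V ⊆ U ∪ V := Set.subset_union_right
  -- Pigeonhole: two of the three points lie in the same connected set, where `f₁` or `f₂` would
  -- change sign without vanishing.
  rcases hxΩ with hx1 | hx1 <;> rcases hyΩ with hy1 | hy1 <;> rcases hzΩ with hz1 | hz1
  · exact key hU hUs hf₁ h₁ hy1 hx1 hy' hx'
  · exact key hU hUs hf₁ h₁ hy1 hx1 hy' hx'
  · exact key hU hUs hf₁ h₁ hz1 hx1 hz' hx'
  · exact key hV hVs hf₂ h₂ hz1 hy1 hz'' hy''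
  · exact key hU hUs hf₂ h₂ hz1 hy1 hz'' hy''
  · exact key hV hVs hf₁ h₁ hz1 hx1 hz' hx'
  · exact key hV hVs hf₁ h₁ hy1 hx1 hy' hx'
  · exact key hV hVs hf₁ h₁ hy1 hx1 hy' hx'

lemma IsOpenDisk.isPreconnected {U : Set IdealBoundary} (h : IsOpenDisk U) : IsPreconnected U := by
  obtain ⟨-, ⟨e⟩⟩ := h
  have hb : IsPreconnected (Metric.ball (0 : ℂ) 1) := (convex_ball 0 1).isPreconnected
  rw [isPreconnected_iff_preconnectedSpace] at hb ⊢
  exact e.symm.surjective.denseRange.preconnectedSpace e.symm.continuous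

lemma IsOpenDisk.nonempty {U : Set IdealBoundary} (h : IsOpenDisk U) : U.Nonempty := by
  obtain ⟨-, ⟨e⟩⟩ := h
  exact ⟨_, (e.symm ⟨0, by simp⟩).2⟩

/-! ### Quasi-Fuchsian representations have no accidental parabolics -/

/-- The circles `Im z = 0` and `Im z = -Im μ` are distinct and tangent at infinity. They lie in the
limit set and leave three regions, all met by the dense domain of discontinuity, which has only two
components. -/
lemma not_isQuasiFuchsian_of_normalForm {ρ : Pi1 →* PSL2C} (hqf : IsQuasiFuchsian ρ) {k μ : ℂ}
    {hk : k ^ 2 = -1} {g : SL2C}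
    (hρ : ∀ w, ρ w = toPSL (g * liftRep (intToSL2C upperTwo) (slantMatrix k μ hk) w * g⁻¹)) :
    False := by
  obtain ⟨hinj, hd, U, V, hU, hV, hdisj, hΩ⟩ := hqf
  have hμ := slant_im_ne_zero hinj hd hρ
  obtain ⟨q₁, hq₁⟩ := hU.nonempty
  obtain ⟨q₂, hq₂⟩ := hV.nonempty
  have hdense : Dense (U ∪ V) := by
    rw [← hΩ]
    refine dense_discontinuityDomain (hdisj.ne_of_mem hq₁ hq₂) ?_ ?_ <;> rw [hΩ]
    · exact Or.inl hq₁
    · exact Or.inr hq₂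
  have hf₁ : ∀ ξ ∈ U ∪ V, circleFun g ξ ≠ 0 := by
    intro ξ hξ h
    rw [← hΩ] at hξ
    exact hξ (mem_limitSet_of_circleFun_eq_zero hρ h)
  have hf₂ : ∀ ξ ∈ U ∪ V, slantCircleFun g μ ξ ≠ 0 := by
    intro ξ hξ h
    rw [← hΩ] at hξ
    exact hξ (mem_limitSet_of_slantCircleFun_eq_zero hρ h)
  have hpt : ∀ y : ℝ, ∃ (ξ : IdealBoundary) (c : ℝ), 0 < c ∧ circleFun g ξ = c * y ∧
      slantCircleFun g μ ξ = c * (y + μ.im) := by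
    intro y
    have hv : (![(y : ℂ) * Complex.I, 1] : Fin 2 → ℂ) ≠ 0 := fun h => by
      simpa using congrFun h 1
    obtain ⟨ξ, hξ⟩ : ∃ ξ : IdealBoundary, ξ.1 = ray (g.1 *ᵥ ![(y : ℂ) * Complex.I, 1]) :=
      ⟨⟨_, ray_mem_idealBoundary (mulVec_ne_zero_SL2C g hv)⟩, rfl⟩
    obtain ⟨c, hc, h1, h2⟩ := circleFun_ray hv hξ
    refine ⟨ξ, c, hc, ?_, ?_⟩
    · rw [h1]; simp
    · rw [h2]; simp
  -- The sign of `Im μ` decides which line is lower; its function is taken as `f₁`. The sample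
  -- points lie on the imaginary axis below, between and above the two lines.
  rcases lt_or_gt_of_ne hμ with h | h
  · refine not_dense_union_of_three_regions hU.isPreconnected hV.isPreconnected hdense
      (continuous_circleFun g) (continuous_slantCircleFun g μ) hf₁ hf₂ ?_ ?_ ?_
    · obtain ⟨ξ, c, hc, h1, -⟩ := hpt (-1)
      exact ⟨ξ, by rw [h1]; nlinarith⟩
    · obtain ⟨ξ, c, hc, h1, h2⟩ := hpt (-μ.im / 2)
      exact ⟨ξ, by rw [h1]; nlinarith, by rw [h2]; nlinarith⟩
    · obtain ⟨ξ, c, hc, h1, h2⟩ := hpt (-2 * μ.im)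
      exact ⟨ξ, by rw [h1]; nlinarith, by rw [h2]; nlinarith⟩
  · refine not_dense_union_of_three_regions hU.isPreconnected hV.isPreconnected hdense
      (continuous_slantCircleFun g μ) (continuous_circleFun g) hf₂ hf₁ ?_ ?_ ?_
    · obtain ⟨ξ, c, hc, -, h2⟩ := hpt (-2 * μ.im)
      exact ⟨ξ, by rw [h2]; nlinarith⟩
    · obtain ⟨ξ, c, hc, h1, h2⟩ := hpt (-μ.im / 2)
      exact ⟨ξ, by rw [h2]; nlinarith, by rw [h1]; nlinarith⟩
    · obtain ⟨ξ, c, hc, h1, h2⟩ := hpt 1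
      exact ⟨ξ, by rw [h2]; nlinarith, by rw [h1]; nlinarith⟩

/-- For `x = 2` the Markov equation is `(z - y)² = -4`. So `k = (z - y) / 2` is a square root of
`-1`, and with `μ = y / k` the normal form has the same three traces, hence is conjugate to the
given pair. -/
lemma IrrRep.trace_ne_two_of_isQuasiFuchsian (ρ : IrrRep) (hqf : IsQuasiFuchsian ρ.1) {A : SL2C}
    (hA : toPSL A = ρ.1 genA) : A.1.trace ≠ 2 := by
  intro htr
  obtain ⟨B, hB⟩ := toPSL_surjective (ρ.1 genB)
  have hm := ρ.markov hA hB
  rw [htr] at hm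
  set y := B.1.trace with hy
  set z := (A * B : SL2C).1.trace with hz
  have hk : ((z - y) / 2) ^ 2 = -1 := by linear_combination hm / 4
  set k := (z - y) / 2 with hkdef
  have hk0 : k ≠ 0 := by rintro h; rw [h] at hk; norm_num at hk
  have e1 : A.1.trace = (intToSL2C upperTwo).1.trace := by
    rw [intToSL2C_upperTwo, htr, Matrix.trace_fin_two_of]; norm_num
  have e2 : B.1.trace = (slantMatrix k (y / k) hk).1.trace := by
    rw [slantMatrix, mkSL_val, Matrix.trace_fin_two_of, ← hy]; field_simp; ring
  have e3 : (A * B : SL2C).1.trace =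
      (intToSL2C upperTwo * slantMatrix k (y / k) hk : SL2C).1.trace := by
    rw [← hz, Matrix.SpecialLinearGroup.coe_mul, intToSL2C_upperTwo, slantMatrix, mkSL_val,
      Matrix.trace_fin_two]
    simp
    field_simp
    rw [hkdef]; ring
  obtain ⟨g, hg1, hg2⟩ := exists_conj_of_trace_eq (A := intToSL2C upperTwo)
    (B := slantMatrix k (y / k) hk) (by
      rw [trace_commutator, ← e1, ← e2, ← e3, ← trace_commutator]
      exact ρ.trace_commutator_ne_two hA hB) e1 e2 e3
  refine not_isQuasiFuchsian_of_normalForm hqf (hk := hk) (g := g) (μ := y / k) fun w => ?_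
  rw [rep_eq_toPSL_liftRep hA hB]
  have : liftRep A B = (MulAut.conj g).toMonoidHom.comp
      (liftRep (intToSL2C upperTwo) (slantMatrix k (y / k) hk)) :=
    hom_ext_gens (by simp [hg1]) (by simp [hg2])
  rw [this]
  rfl

/-- The generator `a` is loxodromic in a quasi-Fuchsian representation. -/
lemma IrrRep.trace_ne_two_mul_cos (ρ : IrrRep) (hqf : IsQuasiFuchsian ρ.1) {A : SL2C}
    (hA : toPSL A = ρ.1 genA) (θ : ℝ) : A.1.trace ≠ 2 * Real.cos θ := by
  intro h
  rcases trace_eq_two_or_neg_two hqf.1 hqf.2.1 hA h with h1 | h1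
  · exact ρ.trace_ne_two_of_isQuasiFuchsian hqf hA h1
  · refine ρ.trace_ne_two_of_isQuasiFuchsian (A := -A) hqf (by rw [toPSL_neg, hA]) ?_
    rw [Matrix.SpecialLinearGroup.coe_neg, Matrix.trace_neg, h1, neg_neg]

lemma qfSpace_subset_range_fnMap (b₀ : ℝ) : QFSpace ⊆ Set.range (fnMap b₀) := by
  rintro _ ⟨ρ, rfl, hqf⟩
  obtain ⟨A, hA⟩ := toPSL_surjective (ρ.1 genA)
  exact mem_range_fnMap b₀ ρ hA (ρ.trace_ne_two_mul_cos hqf hA)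

end PuncturedTorus

end

/-! ### The theorem on the complex Fenchel–Nielsen map -/

theorem mainTheorem6 (b₀ : ℝ) :
    ∃ ψ : PuncturedTorus.fnDomain b₀ → PuncturedTorus.CharVar,
      (∀ (p : PuncturedTorus.fnDomain b₀) (c : PuncturedTorus.CharVar),
        ψ p = c ↔ PuncturedTorus.HasTraceCoords c
          (2 * Complex.cosh (p.1.1 / 2))
          (2 * Complex.cosh (p.1.2 / 2) / Complex.tanh (p.1.1 / 2))
          (2 * Complex.cosh ((p.1.2 + p.1.1) / 2) / Complex.tanh (p.1.1 / 2))) ∧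
      Function.Injective ψ ∧
      PuncturedTorus.QFSpace ⊆ Set.range ψ ∧
      ∀ l : ℂ, 0 < l.re → -Real.pi < l.im → l.im ≤ Real.pi →
        Set.BijOn ψ {p | p.1.1 = l} (PuncturedTorus.linearSlice l) := by
  refine ⟨PuncturedTorus.fnMap b₀, fun p c => ?_, PuncturedTorus.fnMap_injective b₀,
    PuncturedTorus.qfSpace_subset_range_fnMap b₀, fun l hl hl1 hl2 => ⟨?_, ?_, ?_⟩⟩
  · rw [PuncturedTorus.two_cosh_half, PuncturedTorus.fnY_eq, PuncturedTorus.fnZ_eq]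
    exact ⟨fun h => h ▸ PuncturedTorus.fnMap_spec b₀ p,
      fun h => (PuncturedTorus.fnMap_spec b₀ p).unique h⟩
  · rintro p rfl
    exact PuncturedTorus.fnMap_mem_linearSlice b₀ p
  · exact (PuncturedTorus.fnMap_injective b₀).injOn
  · intro c hc
    obtain ⟨p, hp, h⟩ := PuncturedTorus.exists_fnMap_eq b₀ hl hl1 hl2 hc
    exact ⟨p, hp, h⟩
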